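/- **Setup.** Let $P_{\mathcal X}$ be a probability measure on a data space $\mathcal X$, let $p(\cdot\mid x)$ (the law of a random augmentation of $x$) be a Markov kernel from $\mathcal X$ to an augmented space $\mathcal A$ whose $\sigma$-algebra is countably generated, and let $P_{\mathcal A}=\int p(\cdot\mid x)\,dP_{\mathcal X}(x)$. Let $\Gamma^*:L^2(P_{\mathcal A})\to L^2(P_{\mathcal X})$, $(\Gamma^*g)(x)=\int g(a)\,p(da\mid x)=\mathbb E[g(A)\mid x]$, and let $\Gamma:L^2(P_{\mathcal X})\to L^2(P_{\mathcal A})$, $(\Gamma f)(a)=\mathbb E[f(X)\mid a]$, be its adjoint. Write $q_x=\frac{dp(\cdot\mid x)}{dP_{\mathcal A}}$ and let $\kappa\ge 0$ be defined by $$\kappa^2=\operatorname*{ess\,sup}_{x\sim P_{\mathcal X}}K_X(x,x),\qquad K_X(x,x)=\int q_x^2\,dP_{\mathcal A}=D_{\chi^2}\big(p(\cdot\mid x)\,\|\,P_{\mathcal A}\big)+1$$ ($K_X(x,x)=\infty$ if $p(\cdot\mid x)\not\ll P_{\mathcal A}$). Assume $\kappa<\infty$; then $\Gamma^*\Gamma$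 is compact. Let $\lambda_1\ge\lambda_2\ge\dots\ge0$ be its eigenvalues with multiplicity (padded with zeros if the rank is finite), and $S_\lambda(m)=\sum_{i=1}^m\lambda_i$. For an encoder $\hat\Phi=(\hat\phi_1,\dots,\hat\phi_d)$ with $\hat\phi_i\in L^2(P_{\mathcal A})$ put $G=(\langle\hat\phi_i,\hat\phi_j\rangle_{P_{\mathcal A}})_{i,j}$ and $F=(\langle\Gamma^*\hat\phi_i,\Gamma^*\hat\phi_j\rangle_{P_{\mathcal X}})_{i,j}$. Its trace gap is $$\tau^2=\inf_{1\le d'\le d}\ \inf_{h_1,\dots,h_{d'}}\Big(S_\lambda(d'+1)-\operatorname{Tr}(G_h^{-1}F_h)\Big),$$ where $h_1,\dots,h_{d'}$ range over the linear span of $\hat\phi_1,\dots,\hat\phi_d$ with invertible Gram matrix $G_h=(\langle h_i,h_j\rangle_{P_{\mathcal A}})_{i,j}$, and $F_h=(\langle\Gamma^*h_i,\Gamma^*h_j\rangle_{P_{\mathcal X}})_{i,j}$. Given samples $x_1,\dots,x_N$, let $\hat P_{\mathcal A}=\frac1N\sum_k p(\cdot\mid x_k)$ and $$(\bar\Gamma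 f)(a)=\frac{\frac1N\sum_{k}f(x_k)\,q_{x_k}(a)}{\frac1N\sum_k q_{x_k}(a)}\qquad(0/0=0).$$ Let $\bar\lambda_1\ge\bar\lambda_2\ge\dots\ge0$ be the eigenvalues of $\bar\Gamma\Gamma^*$ on $L^2(\hat P_{\mathcal A})$ with multiplicity (padded with zeros), and let $\bar\phi_i$ be corresponding eigenfunctions; those with $\bar\lambda_i>0$ are orthonormal in $L^2(\hat P_{\mathcal A})$, and $\bar\Gamma\Gamma^*$ vanishes on the orthogonal complement of their span. The equation $\bar\Gamma\Gamma^*\bar\phi_i=\bar\lambda_i\bar\phi_i$ is understood $P_{\mathcal A}$-almost everywhere, so that $\bar\phi_i$ vanishes off the support of $\hat P_{\mathcal A}$ when $\bar\lambda_i>0$. **Theorem.** Let $d,N\ge1$ and $\delta>0$, and let $x_1,\dots,x_N$ be i.i.d. from $P_{\mathcal X}$. With probability at least $1-\delta$ the following holds for every choice of the eigenfunctions $\bar\phi_i$ and the encoder $\hat\phi_i=\bar\phi_i$, $i=1,\dots,d$. Let $\gamma_G=\lambda_{\max}(G)/\lambda_{\min}(G)$ be the condition number of $G$. 1. If $\bar\lambda_d>0$,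 then $\hat\phi_1,\dots,\hat\phi_d\in L^2(P_{\mathcal A})$ and $G$ is positive definite. 2. Whenever $\hat\phi_1,\dots,\hat\phi_d\in L^2(P_{\mathcal A})$ and $G$ is positive definite, $\tau^2\le S_\lambda(d+1)-\operatorname{Tr}(G^{-1}F)$. 3. If $\lambda_d>0$ and $\bar\lambda_d>0$, then $$S_\lambda(d+1)-\operatorname{Tr}(G^{-1}F)\le\lambda_{d+1}+\Big(2+\sqrt{2\log\tfrac2\delta}\Big)\frac{\big(\lambda_d^{-1}+\bar\lambda_d^{-1}\gamma_G^{1/2}+2\big)\kappa^2}{\sqrt N}\,d .$$ No eigengap is assumed. -/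

import Mathlib

open MeasureTheory ProbabilityTheory
open scoped ENNReal

noncomputable section

namespace AugRKHS

variable {X A : Type*} [MeasurableSpace X] [MeasurableSpace A]

/-! ### The augmentation operators

The data distribution is `P` and the augmentation is the Markov kernel `Q`, `Q x = p(· | x)`.
The joint law of `(X, A)` is `P ⊗ₘ Q`, and the marginal law of `A` is `Q ∘ₘ P`. -/

/-- `x ↦ E[g(A) | x] = ∫ g(a) p(da | x)`. -/
def avg (Q : Kernel X A) (g : A → ℝ) (x : X) : ℝ := ∫ a, g a ∂(Q x)

theorem memLp_avg (P : Measure X) [IsProbabilityMeasure P] (Q : Kernel X A) [IsMarkovKernel Q]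
    {g : A → ℝ} (hg : MemLp g 2 (Q ∘ₘ P)) :
    MemLp (avg Q g) 2 P ∧ eLpNorm (avg Q g) 2 P ≤ eLpNorm g 2 (Q ∘ₘ P) := by
  have hgm : AEStronglyMeasurable (avg Q g) P := by
    have h1 : AEStronglyMeasurable (fun z : X × A => g z.2) (P ⊗ₘ Q) := by
      have h2 := hg.1
      rw [← Measure.snd_compProd] at h2
      exact h2.comp_measurable measurable_snd
    exact AEStronglyMeasurable.integral_kernel_compProd (κ := Kernel.const Unit P)
      (η := Kernel.prodMkLeft Unit Q) (a := ()) (f := fun z : X × A => g z.2) h1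
  have hle : eLpNorm (avg Q g) 2 P ≤ eLpNorm g 2 (Q ∘ₘ P) := by
    rw [eLpNorm_eq_lintegral_rpow_enorm_toReal (by norm_num) (by norm_num),
      eLpNorm_eq_lintegral_rpow_enorm_toReal (by norm_num) (by norm_num)]
    simp only [ENNReal.toReal_ofNat]
    refine ENNReal.rpow_le_rpow ?_ (by norm_num)
    rw [Measure.lintegral_bind Q.measurable.aemeasurable (by
      have := hg.1.enorm
      exact this.pow_const _)]
    refine lintegral_mono_ae ?_
    have hm : ∀ᵐ x ∂P, AEStronglyMeasurable g (Q x) := by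
      filter_upwards [Measure.ae_ae_of_ae_comp hg.1.ae_eq_mk] with x hx
      exact ⟨_, hg.1.stronglyMeasurable_mk, hx⟩
    filter_upwards [hm] with x hx
    have h1 : ‖avg Q g x‖ₑ ≤ eLpNorm g 2 (Q x) := by
      refine (enorm_integral_le_lintegral_enorm _).trans ?_
      rw [← eLpNorm_one_eq_lintegral_enorm]
      exact eLpNorm_le_eLpNorm_of_exponent_le (by norm_num) hx
    calc ‖avg Q g x‖ₑ ^ (2 : ℝ) ≤ (eLpNorm g 2 (Q x)) ^ (2 : ℝ) := by gcongr
      _ = ∫⁻ a, ‖g a‖ₑ ^ (2 : ℝ) ∂(Q x) := by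
        rw [eLpNorm_eq_lintegral_rpow_enorm_toReal (by norm_num) (by norm_num)]
        simp only [ENNReal.toReal_ofNat]
        rw [← ENNReal.rpow_mul]
        norm_num
  exact ⟨⟨hgm, hle.trans_lt hg.2⟩, hle⟩

theorem avg_congr (P : Measure X) (Q : Kernel X A) {g h : A → ℝ}
    (hgh : g =ᵐ[Q ∘ₘ P] h) : avg Q g =ᵐ[P] avg Q h := by
  filter_upwards [Measure.ae_ae_of_ae_comp hgh] with x hx
  exact integral_congr_ae hx

theorem avg_add (P : Measure X) [IsProbabilityMeasure P] (Q : Kernel X A) [IsMarkovKernel Q]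
    {g h : A → ℝ} (hg : MemLp g 2 (Q ∘ₘ P)) (hh : MemLp h 2 (Q ∘ₘ P)) :
    avg Q (g + h) =ᵐ[P] avg Q g + avg Q h := by
  filter_upwards [Measure.ae_integrable_of_integrable_comp (hg.integrable (by norm_num)),
    Measure.ae_integrable_of_integrable_comp (hh.integrable (by norm_num))] with x h1 h2
  exact integral_add h1 h2

/-- The operator `Γ* : L²(P_A) → L²(P_X)`, `(Γ* g)(x) = E[g(A) | x]`. -/
def augAdj (P : Measure X) [IsProbabilityMeasure P] (Q : Kernel X A) [IsMarkovKernel Q] :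
    Lp ℝ 2 (Q ∘ₘ P) →L[ℝ] Lp ℝ 2 P :=
  LinearMap.mkContinuous
    { toFun := fun g => (memLp_avg P Q (Lp.memLp g)).1.toLp (avg Q g)
      map_add' := fun g h => by
        rw [← MemLp.toLp_add, MemLp.toLp_eq_toLp_iff]
        exact (avg_congr P Q (Lp.coeFn_add g h)).trans (avg_add P Q (Lp.memLp g) (Lp.memLp h))
      map_smul' := fun c g => by
        rw [RingHom.id_apply, ← MemLp.toLp_const_smul, MemLp.toLp_eq_toLp_iff]
        refine (avg_congr P Q (Lp.coeFn_smul c g)).trans (Filter.Eventually.of_forall fun x => ?_)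
        exact integral_const_mul c _ }
    1 (fun g => by
      rw [one_mul, LinearMap.coe_mk, AddHom.coe_mk, Lp.norm_toLp, Lp.norm_def]
      exact ENNReal.toReal_mono (Lp.eLpNorm_ne_top g) (memLp_avg P Q (Lp.memLp g)).2)

theorem augAdj_coeFn (P : Measure X) [IsProbabilityMeasure P] (Q : Kernel X A)
    [IsMarkovKernel Q] (g : Lp ℝ 2 (Q ∘ₘ P)) : augAdj P Q g =ᵐ[P] avg Q g :=
  MemLp.coeFn_toLp (memLp_avg P Q (Lp.memLp g)).1

/-- The augmentation operator `Γ : L²(P_X) → L²(P_A)`, `(Γ f)(a) = E[f(X) | a]`; it is the adjoint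
of `Γ*`. -/
def augOp (P : Measure X) [IsProbabilityMeasure P] (Q : Kernel X A) [IsMarkovKernel Q] :
    Lp ℝ 2 P →L[ℝ] Lp ℝ 2 (Q ∘ₘ P) :=
  ContinuousLinearMap.adjoint (augAdj P Q)

/-- `Γ f` is the conditional expectation of `f(X)` given `A`: it has the same integral as
`f(X)` over every event `{A ∈ B}` of the joint law. -/
theorem setIntegral_augOp (P : Measure X) [IsProbabilityMeasure P] (Q : Kernel X A)
    [IsMarkovKernel Q] (f : Lp ℝ 2 P) {B : Set A} (hB : MeasurableSet B) :
    ∫ a in B, augOp P Q f a ∂(Q ∘ₘ P) = ∫ z in Set.univ ×ˢ B, f z.1 ∂(P ⊗ₘ Q) := by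
  have hfin : (Q ∘ₘ P) B ≠ ∞ := measure_ne_top _ _
  have hf : Integrable f P := (Lp.memLp f).integrable (by norm_num)
  rw [← L2.inner_indicatorConstLp_one hB hfin, augOp,
    ContinuousLinearMap.adjoint_inner_right, L2.inner_def]
  have hI : IntegrableOn (fun z : X × A => f z.1) (Set.univ ×ˢ B) (P ⊗ₘ Q) := by
    refine Integrable.integrableOn ?_
    have : Integrable f (P ⊗ₘ Q).fst := by rwa [Measure.fst_compProd]
    exact this.comp_measurable measurable_fst
  rw [Measure.setIntegral_compProd MeasurableSet.univ hB hI, Measure.restrict_univ]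
  refine integral_congr_ae ?_
  filter_upwards [augAdj_coeFn P Q (indicatorConstLp 2 hB hfin (1 : ℝ)),
    avg_congr P Q (indicatorConstLp_coeFn (p := 2) (hs := hB) (hμs := hfin) (c := (1 : ℝ)))]
    with x h1 h2
  have h3 : avg Q (B.indicator fun _ => (1 : ℝ)) x = (Q x).real B := by
    simp [avg, integral_indicator hB]
  rw [h1, h2, h3]
  simp [mul_comm]

/-! ### Sorted eigenvalues -/

/-- `lam 0 ≥ lam 1 ≥ ⋯ ≥ 0` are the eigenvalues of `T`, repeated by multiplicity and padded with
zeros when `T` has finite rank, and `e i` is an eigenvector for `lam i`; the eigenvectors for the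
nonzero eigenvalues are orthonormal, and `T` vanishes on the orthogonal complement of their span.
(Together with an orthonormal basis of the kernel of `T` they form an orthonormal basis.) -/
structure IsSortedEigensystem {H : Type*} [NormedAddCommGroup H] [InnerProductSpace ℝ H]
    (T : H →L[ℝ] H) (lam : ℕ → ℝ) (e : ℕ → H) : Prop where
  antitone : Antitone lam
  nonneg : ∀ i, 0 ≤ lam i
  eigen : ∀ i, T (e i) = lam i • e i
  orthonormal : Orthonormal ℝ (fun i : {i : ℕ // lam i ≠ 0} => e i)
  complete : ∀ f : H, (∀ i, lam i ≠ 0 → inner ℝ (e i) f = 0) → T f = 0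

/-- `S_λ(m) = λ₁ + ⋯ + λ_m`; the sequence is indexed from `0`, so that `λ_i` is `lam (i - 1)`. -/
def eigSum (lam : ℕ → ℝ) (m : ℕ) : ℝ := ∑ i ∈ Finset.range m, lam i

/-! ### Augmentation complexity -/

/-- The density `p(a | x) / P_A(a)` of `p(· | x)` with respect to `P_A`. -/
def augDensity (P : Measure X) (Q : Kernel X A) (x : X) (a : A) : ℝ≥0∞ :=
  (Q x).rnDeriv (Q ∘ₘ P) a

open Classical in
/-- `K_X(x, x) = ∫ p(a|x)² / P_A(a) da = D_χ²(p(· | x) ‖ P_A) + 1`, with value `∞` when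
`p(· | x)` is not absolutely continuous with respect to `P_A`. -/
def kernelDiag (P : Measure X) (Q : Kernel X A) (x : X) : ℝ≥0∞ :=
  if Q x ≪ Q ∘ₘ P then ∫⁻ a, augDensity P Q x a ^ 2 ∂(Q ∘ₘ P) else ∞

/-- The augmentation complexity `κ = ‖K_X‖_∞^{1/2}`. -/
def augComplexity (P : Measure X) (Q : Kernel X A) : ℝ≥0∞ :=
  (essSup (kernelDiag P Q) P) ^ (1 / 2 : ℝ)

/-! ### Ratio trace and trace gap of an encoder -/

/-- `G(i,j) = ⟨φ_i, φ_j⟩` in `L²(P_A)`. -/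
def gramA (P : Measure X) (Q : Kernel X A) {m : ℕ} (φ : Fin m → A → ℝ) :
    Matrix (Fin m) (Fin m) ℝ :=
  Matrix.of fun i j => ∫ a, φ i a * φ j a ∂(Q ∘ₘ P)

/-- `F(i,j) = ⟨Γ* φ_i, Γ* φ_j⟩` in `L²(P_X)`. -/
def gramX (P : Measure X) (Q : Kernel X A) {m : ℕ} (φ : Fin m → A → ℝ) :
    Matrix (Fin m) (Fin m) ℝ :=
  Matrix.of fun i j => ∫ x, avg Q (φ i) x * avg Q (φ j) x ∂P

/-- The ratio trace `Tr(G⁻¹ F)`. -/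
def ratioTrace (P : Measure X) (Q : Kernel X A) {m : ℕ} (φ : Fin m → A → ℝ) : ℝ :=
  ((gramA P Q φ)⁻¹ * gramX P Q φ).trace

/-- The trace gap `τ²` of an encoder `φ = (φ_1, …, φ_d)`: the infimum, over `1 ≤ d' ≤ d` and over
`h_1, …, h_{d'}` in the span of the `φ_i` with invertible Gram matrix `G_h`, of
`S_λ(d'+1) - Tr(G_h⁻¹ F_h)`. -/
def traceGapSq (P : Measure X) (Q : Kernel X A) (lam : ℕ → ℝ) {d : ℕ} (φ : Fin d → A → ℝ) : ℝ :=
  sInf {t : ℝ | ∃ m : ℕ, 1 ≤ m ∧ m ≤ d ∧ ∃ w : Fin m → Fin d → ℝ,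
    IsUnit (gramA P Q fun i a => ∑ j, w i j * φ j a).det ∧
    t = eigSum lam (m + 1) - ratioTrace P Q (fun i a => ∑ j, w i j * φ j a)}

/-- The condition number `λ_max(G) / λ_min(G)`. -/
def condNumber {m : ℕ} (G : Matrix (Fin m) (Fin m) ℝ) : ℝ :=
  sSup (spectrum ℝ G) / sInf (spectrum ℝ G)

/-! ### The empirical eigenfunctions -/

/-- `P̂_A = N⁻¹ ∑_k p(· | x_k)`. -/
def empMarginal (Q : Kernel X A) {N : ℕ} (x : Fin N → X) : Measure A :=
  (N : ℝ≥0∞)⁻¹ • ∑ k, Q (x k)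

/-- The empirical augmentation operator
`(Γ̄ f)(a) = N⁻¹ ∑_k f(x_k) p(a | x_k) / P̂_A(a)`, where `P̂_A(a) = N⁻¹ ∑_k p(a | x_k)`. All densities
are taken with respect to `P_A`, and `0 / 0 = 0`, that is, `Γ̄ f` is zero off the support of
`P̂_A`. -/
def empAugOp (P : Measure X) (Q : Kernel X A) {N : ℕ} (x : Fin N → X) (f : X → ℝ) (a : A) : ℝ :=
  (N : ℝ)⁻¹ * ∑ k, f (x k) * (augDensity P Q (x k) a).toReal /
    ((N : ℝ)⁻¹ * ∑ l, (augDensity P Q (x l) a).toReal)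

/-- `lamBar 0 ≥ lamBar 1 ≥ ⋯ ≥ 0` are the eigenvalues of `Γ̄ Γ*` (repeated by multiplicity, padded
with zeros) and `φ i` is an eigenfunction for `lamBar i`. The eigenfunctions for the nonzero
eigenvalues are orthonormal in `L²(P̂_A)`, and `Γ̄ Γ*` vanishes on the orthogonal complement of
their span in `L²(P̂_A)`. The eigenvalue equation is required `P_A`-almost everywhere, which says
that the eigenfunctions for nonzero eigenvalues vanish off the support of `P̂_A`, as `Γ̄ f` does. -/
structure IsEmpEigensystem (P : Measure X) (Q : Kernel X A) {N : ℕ} (x : Fin N → X)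
    (lamBar : ℕ → ℝ) (φ : ℕ → A → ℝ) : Prop where
  antitone : Antitone lamBar
  nonneg : ∀ i, 0 ≤ lamBar i
  memLp : ∀ i, MemLp (φ i) 2 (empMarginal Q x)
  eigen : ∀ i, ∀ᵐ a ∂(Q ∘ₘ P), empAugOp P Q x (avg Q (φ i)) a = lamBar i * φ i a
  orthonormal : ∀ i j, lamBar i ≠ 0 → lamBar j ≠ 0 →
    ∫ a, φ i a * φ j a ∂(empMarginal Q x) = if i = j then 1 else 0
  complete : ∀ g : A → ℝ, MemLp g 2 (empMarginal Q x) →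
    (∀ i, lamBar i ≠ 0 → ∫ a, φ i a * g a ∂(empMarginal Q x) = 0) →
    ∀ᵐ a ∂(empMarginal Q x), empAugOp P Q x (avg Q g) a = 0

end AugRKHS

end

open AugRKHS

open MeasureTheory ProbabilityTheory
open scoped ENNReal

namespace AugRKHS

/-! The sum `S_λ̄(d)` of the empirical eigenvalues is the bridge: `S_λ(d+1) - Tr(G⁻¹F)` equals
`λ_{d+1} + (S_λ(d) - S_λ̄(d)) + (S_λ̄(d) - Tr(G⁻¹F))`, and the two differences are bounded
separately. Only quadratic forms are compared, never individual eigenvectors, so no eigengap is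
needed.

Randomness enters through one event (`exists_set_second_moments_close`). With `r = (1 + √(2
log(2/δ)))/√N`, on that event the empirical mean of `(Γ*f)²` is within `κ² r ‖f‖²` of its
expectation, and the `P̂_A`-mean of `g²` is within `κ r ‖g‖_∞ ‖g‖` of its `P_A`-mean, for all `f`
and all bounded `g` at once. Uniformity is free: both quantities pair a test function (`f ⊗ f`,
resp. `g²`) with an average of Hilbert space vectors (`q_x ⊗ q_x`, resp. `q_x`), so it suffices to
bound the norm of one random vector. That norm has a small mean and bounded differences, and
McDiarmid's inequality applies (`exists_set_uniform_deviation`).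

The estimate for `g²` needs sup bounds, which eigenfunctions supply: Cauchy-Schwarz gives `|Γ*g| ≤
κ‖g‖` pointwise, and `Γ`, `Γ̄` are averaging operators. Dividing by the eigenvalue costs `λ_d⁻¹` for
combinations of population eigenfunctions and `λ̄_i⁻¹` for a single empirical one. This is the
origin of the inverse eigenvalues.

For `S_λ(d) - S_λ̄(d)` (`IsEmpEigensystem.eigSum_le_eigSum`) the population eigenfunctions serve as
trial functions for the empirical operator. Their Gram matrix in `L²(P̂_A)` is at most `1 + κ² r
λ_d⁻¹`, and a Ky Fan inequality for such families concludes.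

For `S_λ̄(d) - Tr(G⁻¹F)` (`IsEmpEigensystem.eigSum_le_ratioTrace`) the empirical counterpart of `F`
is the diagonal matrix `D` of the `λ̄_i`, so `F ≥ D - κ² r G`. The trace of `G⁻¹D` sees only the
diagonal of `G⁻¹`, and `(G⁻¹)_ii ≥ 1/G_ii`. Hence the condition number enters only through `γ_G ≥
1`. -/

/-! ### Bounded differences -/

theorem integrable_of_abs_le {Ω : Type*} [MeasurableSpace Ω] {μ : Measure Ω} [IsFiniteMeasure μ]
    {f : Ω → ℝ} (hf : Measurable f) {M : ℝ} (hM : ∀ x, |f x| ≤ M) : Integrable f μ :=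
  Integrable.of_bound hf.aestronglyMeasurable M (Filter.Eventually.of_forall hM)

theorem integrable_exp_of_abs_le {Ω : Type*} [MeasurableSpace Ω] {μ : Measure Ω}
    [IsFiniteMeasure μ] {f : Ω → ℝ} (hf : Measurable f) {M : ℝ} (hM : ∀ x, |f x| ≤ M) :
    Integrable (fun x => Real.exp (f x)) μ :=
  integrable_of_abs_le (M := Real.exp M) (Real.measurable_exp.comp hf) fun x => by
    rw [abs_of_pos (Real.exp_pos _)]
    exact Real.exp_le_exp.2 ((le_abs_self _).trans (hM x))

/-- Hoeffding's lemma for a function of bounded oscillation. -/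
theorem integral_exp_sub_integral_le_of_osc {X : Type*} [MeasurableSpace X] (P : Measure X)
    [IsProbabilityMeasure P] {f : X → ℝ} (hf : Measurable f) {M c : ℝ} (hM : ∀ x, |f x| ≤ M)
    (hbd : ∀ x y, |f x - f y| ≤ c) (s : ℝ) :
    ∫ x, Real.exp (s * (f x - ∫ z, f z ∂P)) ∂P ≤ Real.exp (s ^ 2 * c ^ 2 / 8) := by
  have : Nonempty X := by
    by_contra h
    rw [not_nonempty_iff] at h
    exact IsProbabilityMeasure.ne_zero P (Measure.eq_zero_of_isEmpty P)
  have hbb : BddBelow (Set.range f) := ⟨-M, by rintro _ ⟨x, rfl⟩; exact (abs_le.1 (hM x)).1⟩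
  have hmem : ∀ x, f x ∈ Set.Icc (⨅ y, f y) ((⨅ y, f y) + c) := fun x =>
    ⟨ciInf_le hbb x, by
      have : f x - c ≤ ⨅ y, f y := le_ciInf fun y => by linarith [(abs_le.1 (hbd x y)).2]
      linarith⟩
  have h := (hasSubgaussianMGF_of_mem_Icc (μ := P) hf.aemeasurable
    (Filter.Eventually.of_forall hmem)).mgf_le s
  refine h.trans (Real.exp_le_exp.2 (le_of_eq ?_))
  simp only [add_sub_cancel_left, NNReal.coe_pow, NNReal.coe_div, coe_nnnorm, Real.norm_eq_abs,
    NNReal.coe_ofNat, div_pow, sq_abs]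
  ring

/-- The moment generating function bound behind McDiarmid's bounded difference inequality. -/
theorem integral_exp_sub_integral_le {X : Type*} [MeasurableSpace X] (P : Measure X)
    [IsProbabilityMeasure P] {c M : ℝ} (s : ℝ) (n : ℕ) {f : (Fin n → X) → ℝ} (hf : Measurable f)
    (hM : ∀ x, |f x| ≤ M) (hbd : ∀ x y k, (∀ j, j ≠ k → x j = y j) → |f x - f y| ≤ c) :
    ∫ x, Real.exp (s * (f x - ∫ z, f z ∂Measure.pi fun _ => P)) ∂(Measure.pi fun _ => P)
      ≤ Real.exp (n * (s ^ 2 * c ^ 2 / 8)) := by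
  induction n with
  | zero =>
    have h0 : ∀ x, f x = f default := fun x => congrArg f (Subsingleton.elim _ _)
    simp [h0]
  | succ n ih =>
    set e := MeasurableEquiv.piFinSuccAbove (fun _ : Fin (n + 1) => X) 0 with he
    have hmp := (measurePreserving_piFinSuccAbove (fun _ : Fin (n + 1) => P) 0).symm
    have htr : ∀ F : (Fin (n + 1) → X) → ℝ, ∫ x, F x ∂(Measure.pi fun _ => P)
        = ∫ z, F (e.symm z) ∂(P.prod (Measure.pi fun _ => P)) := fun F =>
      (hmp.integral_comp e.symm.measurableEmbedding F).symm
    set h : X × (Fin n → X) → ℝ := fun z => f (e.symm z) with hh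
    have hhm : Measurable h := hf.comp e.symm.measurable
    have hhM : ∀ z, |h z| ≤ M := fun z => hM _
    have hcons : ∀ z, e.symm z = Fin.cons z.1 z.2 := fun z => by
      simp only [he, MeasurableEquiv.piFinSuccAbove]
      simp [Fin.insertNthEquiv, Fin.insertNth_zero']
    -- Averaging out coordinate `0` keeps the bounded differences of the other coordinates, so the
    -- induction hypothesis applies to `g`, while Hoeffding's lemma handles `h - g` on each section.
    set g : (Fin n → X) → ℝ := fun y => ∫ x, h (x, y) ∂P with hg
    have hgm : Measurable g := hhm.stronglyMeasurable.integral_prod_left'.measurable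
    have hhi : Integrable h (P.prod (Measure.pi fun _ => P)) := integrable_of_abs_le hhm hhM
    have hsec : ∀ y, Measurable fun x => h (x, y) := fun y => hhm.comp (by fun_prop)
    have hsi : ∀ y, Integrable (fun x => h (x, y)) P := fun y =>
      integrable_of_abs_le (hsec y) fun x => hhM _
    have hgM : ∀ y, |g y| ≤ M := fun y => by
      have := norm_integral_le_of_norm_le_const (μ := P) (f := fun x => h (x, y)) (C := M)
        (Filter.Eventually.of_forall fun x => hhM _)
      simpa using this
    have hgbd : ∀ x y k, (∀ j, j ≠ k → x j = y j) → |g x - g y| ≤ c := fun x y k hxy => by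
      rw [hg]
      simp only
      rw [← integral_sub (hsi x) (hsi y)]
      have := norm_integral_le_of_norm_le_const (μ := P)
        (f := fun z => h (z, x) - h (z, y)) (C := c) (Filter.Eventually.of_forall fun z => by
          refine hbd _ _ k.succ fun j hj => ?_
          rw [hcons, hcons]
          induction j using Fin.cases with
          | zero => simp
          | succ j => simpa using hxy j fun h => hj (by rw [h]))
      simpa using this
    have hmean : ∫ x, f x ∂(Measure.pi fun _ => P) = ∫ y, g y ∂(Measure.pi fun _ => P) := by
      rw [htr, integral_prod_symm _ hhi]
    rw [htr, hmean]
    set m := ∫ y, g y ∂(Measure.pi fun _ => P) with hm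
    have hmM : |m| ≤ M := by
      have := norm_integral_le_of_norm_le_const (μ := Measure.pi fun _ : Fin n => P) (f := g)
        (C := M) (Filter.Eventually.of_forall hgM)
      simpa using this
    have hexpI : Integrable (fun z => Real.exp (s * (h z - m)))
        (P.prod (Measure.pi fun _ => P)) :=
      integrable_exp_of_abs_le (M := |s| * (M + M)) (by fun_prop) fun z => by
        rw [abs_mul]
        gcongr
        exact (abs_sub _ _).trans (add_le_add (hhM z) hmM)
    have hgI : Integrable (fun y => Real.exp (s * (g y - m))) (Measure.pi fun _ : Fin n => P) :=
      integrable_exp_of_abs_le (M := |s| * (M + M)) (by fun_prop) fun z => by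
        rw [abs_mul]
        gcongr
        exact (abs_sub _ _).trans (add_le_add (hgM z) hmM)
    change ∫ z, Real.exp (s * (h z - m)) ∂_ ≤ _
    rw [integral_prod_symm _ hexpI]
    calc ∫ y, ∫ x, Real.exp (s * (h (x, y) - m)) ∂P ∂(Measure.pi fun _ => P)
        ≤ ∫ y, Real.exp (s ^ 2 * c ^ 2 / 8) * Real.exp (s * (g y - m))
            ∂(Measure.pi fun _ => P) := by
          refine integral_mono hexpI.integral_prod_right (hgI.const_mul _) fun y => ?_
          have h1 : ∀ x, Real.exp (s * (h (x, y) - m))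
              = Real.exp (s * (h (x, y) - g y)) * Real.exp (s * (g y - m)) := fun x => by
            rw [← Real.exp_add]; ring_nf
          simp only [h1]
          rw [integral_mul_const]
          gcongr
          refine integral_exp_sub_integral_le_of_osc P (hsec y) (fun x => hhM _) (fun x x' => ?_) s
          refine hbd _ _ 0 fun j hj => ?_
          rw [hcons, hcons]
          induction j using Fin.cases with
          | zero => exact absurd rfl hj
          | succ j => simp
      _ = Real.exp (s ^ 2 * c ^ 2 / 8) * ∫ y, Real.exp (s * (g y - m))
            ∂(Measure.pi fun _ => P) := integral_const_mul _ _
      _ ≤ Real.exp (s ^ 2 * c ^ 2 / 8) * Real.exp (n * (s ^ 2 * c ^ 2 / 8)) := by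
          gcongr
          exact ih hgm hgM hgbd
      _ = _ := by
          rw [← Real.exp_add]; push_cast; ring_nf

/-- McDiarmid's bounded difference inequality. -/
theorem measure_bounded_difference_le {X : Type*} [MeasurableSpace X] (P : Measure X)
    [IsProbabilityMeasure P] {c M : ℝ} {n : ℕ} {f : (Fin n → X) → ℝ} (hf : Measurable f)
    (hM : ∀ x, |f x| ≤ M) (hbd : ∀ x y k, (∀ j, j ≠ k → x j = y j) → |f x - f y| ≤ c)
    (hn : 0 < n) (hc : 0 < c) {t : ℝ} (ht : 0 ≤ t) :
    (Measure.pi fun _ => P).real {x | t ≤ f x - ∫ z, f z ∂Measure.pi fun _ => P}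
      ≤ Real.exp (-(2 * t ^ 2 / (n * c ^ 2))) := by
  set m := ∫ z, f z ∂Measure.pi fun _ => P with hm
  have hn' : (0 : ℝ) < n := by exact_mod_cast hn
  have hmM : |m| ≤ M := by
    have := norm_integral_le_of_norm_le_const (μ := Measure.pi fun _ : Fin n => P) (f := f)
      (C := M) (Filter.Eventually.of_forall hM)
    simpa using this
  -- The minimizer of `n s² c² / 8 - s t`.
  set s : ℝ := 4 * t / (n * c ^ 2) with hs
  have hI : Integrable (fun y => Real.exp (s * (f y - m))) (Measure.pi fun _ : Fin n => P) :=
    integrable_exp_of_abs_le (M := |s| * (M + M)) (by fun_prop) fun z => by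
      rw [abs_mul]
      gcongr
      exact (abs_sub _ _).trans (add_le_add (hM z) hmM)
  refine (measure_ge_le_exp_mul_mgf t (by positivity) hI).trans ?_
  refine (mul_le_mul_of_nonneg_left (integral_exp_sub_integral_le P s n hf hM hbd)
    (Real.exp_pos _).le).trans ?_
  rw [← Real.exp_add, Real.exp_le_exp, hs]
  apply le_of_eq
  field_simp
  ring

/-! ### Square integrable functions and concentration in `L²` -/

theorem memLp_two_of_lintegral_le {Ω : Type*} [MeasurableSpace Ω] {μ : Measure Ω} {f : Ω → ℝ}
    (hf : AEStronglyMeasurable f μ) (h : ∫⁻ a, ‖f a‖ₑ ^ 2 ∂μ ≠ ∞) : MemLp f 2 μ := by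
  refine ⟨hf, ?_⟩
  rw [eLpNorm_lt_top_iff_lintegral_rpow_enorm_lt_top (by norm_num) (by norm_num)]
  simpa using h.lt_top

theorem lintegral_enorm_sq_eq {Ω : Type*} [MeasurableSpace Ω] {μ : Measure Ω} {f : Ω → ℝ}
    (hf : MemLp f 2 μ) : ∫⁻ a, ‖f a‖ₑ ^ 2 ∂μ = ENNReal.ofReal (∫ a, f a ^ 2 ∂μ) := by
  rw [ofReal_integral_eq_lintegral_ofReal hf.integrable_sq
    (Filter.Eventually.of_forall fun _ => sq_nonneg _)]
  refine lintegral_congr fun a => ?_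
  rw [← sq_abs, ENNReal.ofReal_pow (abs_nonneg _), ← Real.enorm_eq_ofReal_abs]

theorem inner_toLp {Ω : Type*} [MeasurableSpace Ω] {μ : Measure Ω} {f g : Ω → ℝ}
    (hf : MemLp f 2 μ) (hg : MemLp g 2 μ) :
    inner ℝ (hf.toLp f) (hg.toLp g) = ∫ a, f a * g a ∂μ := by
  rw [L2.inner_def]
  refine integral_congr_ae ?_
  filter_upwards [hf.coeFn_toLp, hg.coeFn_toLp] with a h1 h2
  rw [h1, h2]
  simp [mul_comm]

theorem norm_toLp_eq_sqrt {Ω : Type*} [MeasurableSpace Ω] {μ : Measure Ω} {f : Ω → ℝ}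
    (hf : MemLp f 2 μ) : ‖hf.toLp f‖ = √(∫ a, f a ^ 2 ∂μ) := by
  rw [norm_eq_sqrt_real_inner, inner_toLp]
  simp only [pow_two]

theorem abs_integral_mul_le {Ω : Type*} [MeasurableSpace Ω] {μ : Measure Ω} {f g : Ω → ℝ}
    (hf : MemLp f 2 μ) (hg : MemLp g 2 μ) :
    |∫ a, f a * g a ∂μ| ≤ √(∫ a, f a ^ 2 ∂μ) * √(∫ a, g a ^ 2 ∂μ) := by
  rw [← inner_toLp hf hg, ← norm_toLp_eq_sqrt hf, ← norm_toLp_eq_sqrt hg]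
  exact abs_real_inner_le_norm _ _

theorem sq_integral_le_integral_sq {Ω : Type*} [MeasurableSpace Ω] {μ : Measure Ω}
    [IsProbabilityMeasure μ] {f : Ω → ℝ} (hf : MemLp f 2 μ) :
    (∫ a, f a ∂μ) ^ 2 ≤ ∫ a, f a ^ 2 ∂μ := by
  have h1 := variance_eq_sub hf
  have h2 := variance_nonneg f μ
  simp only [Pi.pow_apply] at h1
  linarith

/-- The mean square deviation of an empirical mean. -/
theorem integral_sq_empirical_sub_mean_le {X : Type*} [MeasurableSpace X] (P : Measure X)
    [IsProbabilityMeasure P] {f : X → ℝ} (hf : MemLp f 2 P) {N : ℕ} (hN : 1 ≤ N) :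
    ∫ x, ((N : ℝ)⁻¹ * ∑ k, f (x k) - ∫ z, f z ∂P) ^ 2 ∂(Measure.pi fun _ : Fin N => P)
      ≤ (N : ℝ)⁻¹ * ∫ z, f z ^ 2 ∂P := by
  have hN' : (N : ℝ) ≠ 0 := by positivity
  set Y : (Fin N → X) → ℝ := ∑ i : Fin N, fun x => (N : ℝ)⁻¹ * f (x i) with hY
  have hYe : ∀ x, Y x = (N : ℝ)⁻¹ * ∑ k, f (x k) := fun x => by
    simp [hY, Finset.sum_apply, Finset.mul_sum]
  have hmem : ∀ i : Fin N, MemLp (fun x : Fin N → X => (N : ℝ)⁻¹ * f (x i)) 2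
      (Measure.pi fun _ => P) := fun i =>
    (hf.comp_measurePreserving (measurePreserving_eval (fun _ : Fin N => P) i)).const_mul _
  have hmean : ∫ x, Y x ∂(Measure.pi fun _ => P) = ∫ z, f z ∂P := by
    simp only [hY, Finset.sum_apply]
    rw [integral_finsetSum _ fun i _ => (hmem i).integrable (by norm_num)]
    have : ∀ i : Fin N, ∫ x : Fin N → X, (N : ℝ)⁻¹ * f (x i) ∂(Measure.pi fun _ => P)
        = (N : ℝ)⁻¹ * ∫ z, f z ∂P := fun i => by
      rw [integral_const_mul, integral_comp_eval (μ := fun _ : Fin N => P) hf.1]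
    simp only [this, Finset.sum_const, Finset.card_univ, Fintype.card_fin, nsmul_eq_mul]
    field_simp
  have hvar := variance_eq_integral (X := Y) (μ := Measure.pi fun _ : Fin N => P)
    (by
      rw [hY]
      exact Finset.aemeasurable_sum _ fun i _ => (hmem i).1.aemeasurable)
  rw [hmean] at hvar
  simp only [hYe] at hvar
  rw [← hvar, hY, variance_sum_pi (X := fun _ z => (N : ℝ)⁻¹ * f z) fun i => hf.const_mul _]
  simp only [variance_const_mul, Finset.sum_const, Finset.card_univ, Fintype.card_fin, nsmul_eq_mul]
  have := variance_le_expectation_sq (μ := P) hf.1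
  simp only [Pi.pow_apply] at this
  calc (N : ℝ) * ((N : ℝ)⁻¹ ^ 2 * Var[f; P]) = (N : ℝ)⁻¹ * Var[f; P] := by field_simp
    _ ≤ _ := by gcongr

/-- Uniform concentration of an empirical mean of square integrable functions, tested against all
square integrable functions. -/
theorem exists_set_uniform_deviation {X B : Type*} [MeasurableSpace X] [MeasurableSpace B]
    (P : Measure X) [IsProbabilityMeasure P] (μ : Measure B) [IsProbabilityMeasure μ]
    {v : X → B → ℝ} (hv : Measurable (Function.uncurry v)) {K : ℝ} (hK : 0 < K)
    (hvK : ∀ x, ∫⁻ b, ‖v x b‖ₑ ^ 2 ∂μ ≤ ENNReal.ofReal (K ^ 2)) {N : ℕ} (hN : 1 ≤ N)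
    {δ : ℝ} (hδ : 0 < δ) (hδ1 : δ ≤ 1) :
    ∃ E : Set (Fin N → X), MeasurableSet E ∧
      (Measure.pi fun _ => P) Eᶜ ≤ ENNReal.ofReal δ ∧
      ∀ x ∈ E, ∀ h : B → ℝ, MemLp h 2 μ →
        |(N : ℝ)⁻¹ * ∑ k, ∫ b, h b * v (x k) b ∂μ - ∫ z, ∫ b, h b * v z b ∂μ ∂P|
          ≤ √(∫ b, h b ^ 2 ∂μ) * (K * (1 + √(2 * Real.log (1 / δ))) / √N) := by
  have hN0 : (0 : ℝ) < N := by exact_mod_cast hN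
  have hvx : ∀ x, MemLp (v x) 2 μ := fun x => memLp_two_of_lintegral_le
    (hv.of_uncurry_left).aestronglyMeasurable ((hvK x).trans_lt ENNReal.ofReal_lt_top).ne
  have hvx2 : ∀ x, ∫ b, v x b ^ 2 ∂μ ≤ K ^ 2 := fun x => by
    have := hvK x
    rwa [lintegral_enorm_sq_eq (hvx x), ENNReal.ofReal_le_ofReal_iff (by positivity)] at this
  have hvprod : MemLp (Function.uncurry v) 2 (P.prod μ) := by
    refine memLp_two_of_lintegral_le hv.aestronglyMeasurable ?_
    rw [lintegral_prod _ (by fun_prop)]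
    refine ((lintegral_mono hvK).trans_lt ?_).ne
    simp
  have hsq : Integrable (fun z : X × B => v z.1 z.2 ^ 2) (P.prod μ) := hvprod.integrable_sq
  have hvb : ∀ᵐ b ∂μ, MemLp (fun z => v z b) 2 P := by
    filter_upwards [hsq.prod_left_ae] with b hb
    have hvb : Measurable fun z => v z b := hv.comp (by fun_prop : Measurable fun z : X => (z, b))
    exact (memLp_two_iff_integrable_sq hvb.aestronglyMeasurable).2 hb
  set m : B → ℝ := fun b => ∫ z, v z b ∂P with hm
  have hmm : Measurable m := hv.stronglyMeasurable.integral_prod_left'.measurable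
  have hm2 : Integrable (fun b => ∫ z, v z b ^ 2 ∂P) μ := hsq.integral_prod_right
  have hmle : ∀ᵐ b ∂μ, m b ^ 2 ≤ ∫ z, v z b ^ 2 ∂P := by
    filter_upwards [hvb] with b hb using sq_integral_le_integral_sq hb
  have hmL : MemLp m 2 μ := by
    rw [memLp_two_iff_integrable_sq hmm.aestronglyMeasurable]
    refine hm2.mono' (hmm.pow_const 2).aestronglyMeasurable ?_
    filter_upwards [hmle] with b hb
    rwa [Real.norm_eq_abs, abs_of_nonneg (sq_nonneg _)]
  have hint2 : ∫ b, ∫ z, v z b ^ 2 ∂P ∂μ ≤ K ^ 2 := by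
    rw [← integral_prod_symm _ hsq, integral_prod _ hsq]
    calc ∫ x, ∫ b, v x b ^ 2 ∂μ ∂P ≤ ∫ _, K ^ 2 ∂P :=
          integral_mono hsq.integral_prod_left (integrable_const _) hvx2
      _ = K ^ 2 := by simp
  have hmK : ∫ b, m b ^ 2 ∂μ ≤ K ^ 2 :=
    (integral_mono_ae hmL.integrable_sq hm2 hmle).trans hint2
  set V : X → Lp ℝ 2 μ := fun x => (hvx x).toLp (v x) with hV
  have hVK : ∀ x, ‖V x‖ ≤ K := fun x => by
    rw [hV, norm_toLp_eq_sqrt, Real.sqrt_le_left hK.le]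
    exact hvx2 x
  set D : (Fin N → X) → B → ℝ := fun x b => (N : ℝ)⁻¹ * ∑ k, v (x k) b - m b with hD
  have hDm : Measurable (Function.uncurry D) := by
    have h1 : ∀ k : Fin N, Measurable fun p : (Fin N → X) × B => v (p.1 k) p.2 := fun k =>
      hv.comp (by fun_prop : Measurable fun p : (Fin N → X) × B => (p.1 k, p.2))
    exact ((Finset.measurable_sum _ fun k _ => h1 k).const_mul _).sub (hmm.comp measurable_snd)
  have hDx : ∀ x, MemLp (D x) 2 μ := fun x =>
    ((memLp_finsetSum _ fun k _ => hvx (x k)).const_mul _).sub hmL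
  have hDV : ∀ x, (hDx x).toLp (D x) = (N : ℝ)⁻¹ • ∑ k, V (x k) - hmL.toLp m := fun x => by
    apply Lp.ext
    have hs : ∀ k, V (x k) =ᵐ[μ] v (x k) := fun k => (hvx (x k)).coeFn_toLp
    filter_upwards [(hDx x).coeFn_toLp, Lp.coeFn_sub ((N : ℝ)⁻¹ • ∑ k, V (x k)) (hmL.toLp m),
      Lp.coeFn_smul (N : ℝ)⁻¹ (∑ k, V (x k)), hmL.coeFn_toLp,
      Lp.coeFn_finsetSum Finset.univ (fun k => V (x k)),
      ae_all_iff.2 hs] with b h1 h2 h3 h4 h5 h6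
    rw [h1, h2, Pi.sub_apply, h3, Pi.smul_apply, h4, h5]
    simp [hD, h6]
  -- The `L²(μ)` norm of the deviation. By Cauchy-Schwarz it controls every test function `h` at
  -- once, so concentration is needed for this single scalar only.
  set F : (Fin N → X) → ℝ := fun x => √(∫ b, D x b ^ 2 ∂μ) with hF
  have hFV : ∀ x, F x = ‖(N : ℝ)⁻¹ • ∑ k, V (x k) - hmL.toLp m‖ := fun x => by
    rw [hF, ← hDV, norm_toLp_eq_sqrt]
  have hFm : Measurable F := by
    have : StronglyMeasurable fun x => ∫ b, D x b ^ 2 ∂μ :=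
      StronglyMeasurable.integral_prod_right' (f := fun p : (Fin N → X) × B => D p.1 p.2 ^ 2)
        (hDm.pow_const 2).stronglyMeasurable
    exact this.measurable.sqrt
  have hF0 : ∀ x, 0 ≤ F x := fun x => Real.sqrt_nonneg _
  have hmn : ‖hmL.toLp m‖ ≤ K := by
    rw [norm_toLp_eq_sqrt, Real.sqrt_le_left hK.le]
    exact hmK
  have hFM : ∀ x, |F x| ≤ 2 * K := fun x => by
    rw [abs_of_nonneg (hF0 x), hFV]
    have h1 : ‖(N : ℝ)⁻¹ • ∑ k, V (x k)‖ ≤ K := by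
      rw [norm_smul, norm_inv, Real.norm_natCast]
      have : ‖∑ k, V (x k)‖ ≤ N * K := (norm_sum_le _ _).trans
        ((Finset.sum_le_sum fun k _ => hVK (x k)).trans (by simp))
      calc (N : ℝ)⁻¹ * ‖∑ k, V (x k)‖ ≤ (N : ℝ)⁻¹ * (N * K) := by gcongr
        _ = K := by field_simp
    linarith [norm_sub_le ((N : ℝ)⁻¹ • ∑ k, V (x k)) (hmL.toLp m)]
  have hFbd : ∀ x y k, (∀ j, j ≠ k → x j = y j) → |F x - F y| ≤ 2 * K / N := fun x y k hxy => by
    rw [hFV, hFV]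
    refine (abs_norm_sub_norm_le _ _).trans ?_
    have hsum : ∑ j, V (x j) - ∑ j, V (y j) = V (x k) - V (y k) := by
      rw [← Finset.sum_sub_distrib, Finset.sum_eq_single k]
      · intro j _ hj
        rw [hxy j hj, sub_self]
      · simp
    rw [sub_sub_sub_cancel_right, ← smul_sub, hsum, norm_smul, norm_inv, Real.norm_natCast,
      div_eq_inv_mul]
    gcongr
    linarith [norm_sub_le (V (x k)) (V (y k)), hVK (x k), hVK (y k)]
  have hFL : MemLp F 2 (Measure.pi fun _ => P) :=
    MemLp.of_bound hFm.aestronglyMeasurable (2 * K) (Filter.Eventually.of_forall hFM)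
  -- After exchanging the integrals this is the scalar variance bound at each fixed `b`.
  have hF2 : ∫ x, F x ^ 2 ∂(Measure.pi fun _ => P) ≤ K ^ 2 / N := by
    have h1 : ∀ x, F x ^ 2 = ∫ b, D x b ^ 2 ∂μ := fun x =>
      Real.sq_sqrt (integral_nonneg fun b => sq_nonneg _)
    have hDI : Integrable (fun p : (Fin N → X) × B => D p.1 p.2 ^ 2)
        ((Measure.pi fun _ => P).prod μ) := by
      have hDm2 : Measurable fun p : (Fin N → X) × B => D p.1 p.2 ^ 2 := hDm.pow_const 2
      rw [integrable_prod_iff hDm2.aestronglyMeasurable]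
      refine ⟨Filter.Eventually.of_forall fun x => (hDx x).integrable_sq, ?_⟩
      have := hFL.integrable_sq
      simp only [h1] at this
      simpa using this
    simp only [h1]
    rw [← integral_prod _ hDI, integral_prod_symm _ hDI]
    calc ∫ b, ∫ x, D x b ^ 2 ∂(Measure.pi fun _ => P) ∂μ
        ≤ ∫ b, (N : ℝ)⁻¹ * ∫ z, v z b ^ 2 ∂P ∂μ := by
          refine integral_mono_ae hDI.integral_prod_right (hm2.const_mul _) ?_
          filter_upwards [hvb] with b hb
          exact integral_sq_empirical_sub_mean_le P hb hN
      _ ≤ K ^ 2 / N := by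
          rw [integral_const_mul, div_eq_inv_mul]
          gcongr
  have hsN : 0 < √(N : ℝ) := Real.sqrt_pos.2 hN0
  have hEF : ∫ x, F x ∂(Measure.pi fun _ => P) ≤ K / √N := by
    refine le_of_sq_le_sq ?_ (by positivity)
    rw [div_pow, Real.sq_sqrt hN0.le]
    exact (sq_integral_le_integral_sq hFL).trans hF2
  set L : ℝ := √(2 * Real.log (1 / δ)) with hL
  -- With differences `2K/N` the McDiarmid exponent `2t²/(N(2K/N)²)` becomes `L²/2 = log (1/δ)`.
  set t : ℝ := K * L / √N with ht
  have hlog : 0 ≤ Real.log (1 / δ) := Real.log_nonneg (by rw [le_div_iff₀ hδ]; linarith)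
  set EF := ∫ x, F x ∂(Measure.pi fun _ => P) with hEFdef
  refine ⟨{x | F x - EF < t}, measurableSet_lt (by fun_prop) measurable_const, ?_, ?_⟩
  · have hbound := measure_bounded_difference_le P hFm hFM hFbd hN (by positivity) (t := t)
      (by positivity)
    have hcompl : {x | F x - EF < t}ᶜ = {x | t ≤ F x - EF} := by
      ext x
      simp
    rw [hcompl, ← ofReal_measureReal]
    refine ENNReal.ofReal_le_ofReal (hbound.trans ?_)
    have : -(2 * t ^ 2 / (N * (2 * K / N) ^ 2)) = Real.log δ := by
      have hL2 : L ^ 2 = -(2 * Real.log δ) := by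
        rw [hL, Real.sq_sqrt (by positivity), one_div, Real.log_inv]
        ring
      rw [ht, div_pow, Real.sq_sqrt hN0.le, mul_pow, hL2]
      field_simp
    rw [this, Real.exp_log hδ]
  · intro x hx h hh
    have hFx : F x ≤ K * (1 + L) / √N := by
      have : F x - EF < t := hx
      have h2 : K * (1 + L) / √N = K / √N + t := by rw [ht]; ring
      linarith
    have hhp : MemLp (fun p : X × B => h p.2) 2 (P.prod μ) :=
      hh.comp_measurePreserving measurePreserving_snd
    have hhv : Integrable (fun p : X × B => h p.2 * v p.1 p.2) (P.prod μ) :=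
      hhp.integrable_mul hvprod
    have hfub : ∫ z, ∫ b, h b * v z b ∂μ ∂P = ∫ b, h b * m b ∂μ := by
      rw [← integral_prod _ hhv, integral_prod_symm _ hhv]
      refine integral_congr_ae (Filter.Eventually.of_forall fun b => ?_)
      exact integral_const_mul (h b) fun z => v z b
    have hsum : (N : ℝ)⁻¹ * ∑ k, ∫ b, h b * v (x k) b ∂μ - ∫ z, ∫ b, h b * v z b ∂μ ∂P
        = ∫ b, h b * D x b ∂μ := by
      have hi : ∀ k, Integrable (fun b => h b * v (x k) b) μ := fun k =>
        hh.integrable_mul (hvx (x k))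
      have hhm : Integrable (fun b => h b * m b) μ := hh.integrable_mul hmL
      rw [hfub, ← integral_finsetSum _ fun k _ => hi k, ← integral_const_mul,
        ← integral_sub ((integrable_finsetSum _ fun k _ => hi k).const_mul _) hhm]
      refine integral_congr_ae (Filter.Eventually.of_forall fun b => ?_)
      simp only [hD, ← Finset.mul_sum]
      ring
    rw [hsum]
    refine (abs_integral_mul_le hh (hDx x)).trans ?_
    gcongr

/-! ### Matrices -/

open scoped MatrixOrder in
-- Writing `G⁻¹ = W*W` turns the trace into that of `W M W*`. In this way inequalities between
-- quadratic forms become inequalities between ratio traces.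
theorem trace_inv_mul_nonneg {m : ℕ} {G M : Matrix (Fin m) (Fin m) ℝ} (hG : G.PosDef)
    (hM : M.PosSemidef) : 0 ≤ (G⁻¹ * M).trace := by
  obtain ⟨W, hW⟩ := CStarAlgebra.nonneg_iff_eq_star_mul_self.1 hG.inv.posSemidef.nonneg
  rw [hW, Matrix.star_eq_conjTranspose, Matrix.mul_assoc, Matrix.trace_mul_comm]
  exact (hM.mul_mul_conjTranspose_same W).trace_nonneg

/-- This is `1 ≤ G_ii (G⁻¹)_ii`, in a form without division that also covers `s ≤ 0`. For `s > 0` it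
follows from positivity of the form of `G` at `e_i - s⁻¹ G⁻¹ e_i`. -/
theorem le_inv_diag {m : ℕ} {G : Matrix (Fin m) (Fin m) ℝ} (hG : G.PosDef) (i : Fin m) {s : ℝ}
    (hs : s * G i i ≤ 1) : s ≤ G⁻¹ i i := by
  have hg : 0 < G⁻¹ i i := hG.inv.diag_pos
  rcases le_or_gt s 0 with h | h
  · linarith
  have hdet : IsUnit G.det := (Matrix.isUnit_iff_isUnit_det _).1 hG.isUnit
  set u : Fin m → ℝ := G⁻¹.mulVec (Pi.single i 1) with hu
  have hGu : G.mulVec u = Pi.single i 1 := by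
    rw [hu, Matrix.mulVec_mulVec, Matrix.mul_nonsing_inv _ hdet, Matrix.one_mulVec]
  have hui : u i = G⁻¹ i i := by simp [hu]
  have hsymm : dotProduct u (G.mulVec (Pi.single i 1)) = 1 := by
    rw [Matrix.dotProduct_mulVec, ← Matrix.mulVec_transpose]
    have : G.transpose = G := by simpa using hG.isHermitian.eq
    rw [this, hGu]
    simp
  have key := hG.posSemidef.dotProduct_mulVec_nonneg (Pi.single i 1 - s⁻¹ • u)
  simp only [star_trivial, Matrix.mulVec_sub, Matrix.mulVec_smul, hGu, sub_dotProduct,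
    dotProduct_sub, smul_dotProduct, dotProduct_smul, hsymm] at key
  simp [hui] at key
  have h1 : s * G i i - 1 - (1 - s⁻¹ * G⁻¹ i i) ≥ 0 := by
    have := mul_nonneg h.le (sub_nonneg.2 key)
    have e : s * (G i i - s⁻¹ - s⁻¹ * (1 - s⁻¹ * G⁻¹ i i))
        = s * G i i - 1 - (1 - s⁻¹ * G⁻¹ i i) := by
      field_simp
    linarith
  have h2 : 1 ≤ s⁻¹ * G⁻¹ i i := by linarith
  calc s = s * 1 := by ring
    _ ≤ s * (s⁻¹ * G⁻¹ i i) := by gcongr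
    _ = _ := by field_simp

theorem one_le_condNumber {m : ℕ} (hm : 1 ≤ m) {G : Matrix (Fin m) (Fin m) ℝ} (hG : G.PosDef) :
    1 ≤ condNumber G := by
  have : Nonempty (Fin m) := ⟨⟨0, hm⟩⟩
  rw [condNumber, hG.isHermitian.spectrum_real_eq_range_eigenvalues]
  have hfin : (Set.range hG.isHermitian.eigenvalues).Finite := Set.finite_range _
  have hne : (Set.range hG.isHermitian.eigenvalues).Nonempty := Set.range_nonempty _
  have hpos : 0 < sInf (Set.range hG.isHermitian.eigenvalues) := by
    obtain ⟨i, hi⟩ := hne.csInf_mem hfin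
    rw [← hi]
    exact hG.eigenvalues_pos i
  rw [le_div_iff₀ hpos, one_mul]
  exact csInf_le_csSup hne hfin.bddBelow hfin.bddAbove

/-! ### A Ky Fan inequality -/

section KyFan

variable {H : Type*} [NormedAddCommGroup H] [InnerProductSpace ℝ H]

/-- Bessel's inequality for a family with bounded Gram matrix. -/
theorem sum_sq_inner_le_of_gram_le {d : ℕ} {f : Fin d → H} {C : ℝ} (hC : 0 ≤ C)
    (hf : ∀ c : Fin d → ℝ, ‖∑ i, c i • f i‖ ^ 2 ≤ C * ∑ i, c i ^ 2) {e : H} (he : ‖e‖ = 1) :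
    ∑ i, inner ℝ (f i) e ^ 2 ≤ C := by
  set w := ∑ i, inner ℝ (f i) e ^ 2 with hw
  have hw0 : 0 ≤ w := Finset.sum_nonneg fun i _ => sq_nonneg _
  set g := ∑ i, inner ℝ (f i) e • f i with hg
  have h1 : inner ℝ g e = w := by
    rw [hg, sum_inner, hw]
    refine Finset.sum_congr rfl fun i _ => ?_
    rw [real_inner_smul_left, pow_two]
  have h2 : w ≤ ‖g‖ := by
    have := real_inner_le_norm g e
    rwa [h1, he, mul_one] at this
  have h3 : w ^ 2 ≤ C * w := (pow_le_pow_left₀ hw0 h2 2).trans (hf _)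
  rcases hw0.eq_or_lt with h | h
  · rwa [← h]
  · nlinarith

/-- The eigenvectors for nonzero eigenvalues extend to a Hilbert basis that diagonalizes `T`; every
basis vector with eigenvalue above `lam n` is orthogonal to `r`. -/
theorem IsSortedEigensystem.inner_map_self_le [CompleteSpace H] {T : H →L[ℝ] H} {lam : ℕ → ℝ}
    {e : ℕ → H} (hT : IsSortedEigensystem T lam e) (hs : ∀ x y, inner ℝ (T x) y = inner ℝ x (T y))
    {n : ℕ} {r : H} (hr : ∀ j < n, lam j ≠ 0 → inner ℝ (e j) r = 0) :
    inner ℝ r (T r) ≤ lam n * ‖r‖ ^ 2 := by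
  classical
  have hinj : Function.Injective fun i : {i : ℕ // lam i ≠ 0} => e i :=
    hT.orthonormal.linearIndependent.injective
  obtain ⟨w, b, hsw, hb⟩ := hT.orthonormal.toSubtypeRange.exists_hilbertBasis_extension
  have hbT : ∀ k : w, ∃ μ : ℝ, T (b k) = μ • b k ∧ (inner ℝ (b k) r ≠ 0 → μ ≤ lam n) := by
    intro k
    have hbk : b k = (k : H) := congrFun hb k
    by_cases hk : (k : H) ∈ Set.range fun i : {i : ℕ // lam i ≠ 0} => e i
    · obtain ⟨⟨i, hi⟩, hik⟩ := hk
      simp only at hik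
      refine ⟨lam i, by rw [hbk, ← hik, hT.eigen], fun hne => ?_⟩
      by_contra hlt
      have hin : i < n := by
        by_contra hge
        exact hlt (hT.antitone (not_lt.1 hge))
      exact hne (by rw [hbk, ← hik, hr i hin hi])
    -- A basis vector that is not one of the eigenvectors is orthogonal to all of them, so
    -- `complete` puts it in the kernel.
    · refine ⟨0, ?_, fun _ => hT.nonneg n⟩
      rw [zero_smul]
      refine hT.complete _ fun i hi => ?_
      have hmem : e i ∈ w := hsw ⟨⟨i, hi⟩, rfl⟩
      have hne : (⟨e i, hmem⟩ : w) ≠ k := fun h => hk ⟨⟨i, hi⟩, by rw [← h]⟩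
      have := b.orthonormal.2 hne
      rwa [hb] at this ⊢
  choose μ hμ hμn using hbT
  have h1 := b.hasSum_inner_mul_inner r (T r)
  have h2 := (b.hasSum_inner_mul_inner r r).mul_left (lam n)
  rw [real_inner_self_eq_norm_sq] at h2
  refine hasSum_le (fun k => ?_) h1 h2
  rw [← hs, hμ, real_inner_smul_left, real_inner_comm]
  by_cases h0 : inner ℝ (b k) r = 0
  · simp [h0]
  · nlinarith [hμn k h0, mul_self_nonneg (inner ℝ (b k) r)]

/-- Split `f` into its projection `p` onto the first `n + 1` eigenvectors and a remainder `r`; `T`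
has no cross terms. Subtracting `lam n` makes the weights `lam j - lam n` nonnegative, so that a
Bessel bound can be inserted term by term. Positivity of `lam n` is what makes these eigenvectors
orthonormal. -/
theorem IsSortedEigensystem.inner_map_self_le_add_sum [CompleteSpace H] {T : H →L[ℝ] H}
    {lam : ℕ → ℝ} {e : ℕ → H} (hT : IsSortedEigensystem T lam e)
    (hs : ∀ x y, inner ℝ (T x) y = inner ℝ x (T y)) {n : ℕ} (hn : 0 < lam n) (f : H) :
    inner ℝ f (T f) ≤ lam n * ‖f‖ ^ 2
      + ∑ j ∈ Finset.range (n + 1), (lam j - lam n) * inner ℝ (e j) f ^ 2 := by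
  have hpos : ∀ j ∈ Finset.range (n + 1), lam j ≠ 0 := fun j hj =>
    (hn.trans_le (hT.antitone (Nat.lt_succ_iff.1 (Finset.mem_range.1 hj)))).ne'
  have horth : ∀ i ∈ Finset.range (n + 1), ∀ j ∈ Finset.range (n + 1),
      inner ℝ (e i) (e j) = if i = j then (1 : ℝ) else 0 := fun i hi j hj => by
    have := orthonormal_iff_ite.1 hT.orthonormal ⟨i, hpos i hi⟩ ⟨j, hpos j hj⟩
    simpa using this
  set p := ∑ j ∈ Finset.range (n + 1), inner ℝ (e j) f • e j with hp
  have hep : ∀ j ∈ Finset.range (n + 1), inner ℝ (e j) p = inner ℝ (e j) f := fun j hj => by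
    rw [hp, inner_sum, Finset.sum_eq_single j]
    · rw [real_inner_smul_right, horth j hj j hj, if_pos rfl, mul_one]
    · intro i hi hij
      rw [real_inner_smul_right, horth j hj i hi, if_neg hij.symm, mul_zero]
    · exact fun h => absurd hj h
  set r := f - p with hr
  have her : ∀ j ∈ Finset.range (n + 1), inner ℝ (e j) r = 0 := fun j hj => by
    rw [hr, inner_sub_right, hep j hj, sub_self]
  have hTp : T p = ∑ j ∈ Finset.range (n + 1), (inner ℝ (e j) f * lam j) • e j := by
    rw [hp, map_sum]
    refine Finset.sum_congr rfl fun j _ => ?_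
    rw [map_smul, hT.eigen, smul_smul]
  have hrp : inner ℝ r p = 0 := by
    rw [hp, inner_sum]
    refine Finset.sum_eq_zero fun j hj => ?_
    rw [real_inner_smul_right, real_inner_comm (e j) r, her j hj, mul_zero]
  have hrTp : inner ℝ r (T p) = 0 := by
    rw [hTp, inner_sum]
    refine Finset.sum_eq_zero fun j hj => ?_
    rw [real_inner_smul_right, real_inner_comm (e j) r, her j hj, mul_zero]
  have hpTr : inner ℝ p (T r) = 0 := by
    rw [← hs, real_inner_comm, hrTp]
  have hpTp : inner ℝ p (T p) = ∑ j ∈ Finset.range (n + 1), lam j * inner ℝ (e j) f ^ 2 := by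
    rw [hTp, inner_sum]
    refine Finset.sum_congr rfl fun j hj => ?_
    rw [real_inner_smul_right, real_inner_comm (e j) p, hep j hj]
    ring
  have hpp : ‖p‖ ^ 2 = ∑ j ∈ Finset.range (n + 1), inner ℝ (e j) f ^ 2 := by
    rw [← real_inner_self_eq_norm_sq]
    nth_rw 2 [hp]
    rw [inner_sum]
    refine Finset.sum_congr rfl fun j hj => ?_
    rw [real_inner_smul_right, real_inner_comm (e j) p, hep j hj]
    ring
  have hfpr : f = p + r := by rw [hr]; abel
  have hnorm : ‖f‖ ^ 2 = ‖p‖ ^ 2 + ‖r‖ ^ 2 := by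
    rw [hfpr, ← real_inner_self_eq_norm_sq, inner_add_left, inner_add_right, inner_add_right, hrp,
      real_inner_comm r p, hrp, real_inner_self_eq_norm_sq, real_inner_self_eq_norm_sq]
    ring
  have hrr := hT.inner_map_self_le hs (n := n) (r := r) fun j hj _ =>
    her j (Finset.mem_range.2 (by omega))
  have hTf : inner ℝ f (T f) = inner ℝ p (T p) + inner ℝ r (T r) := by
    rw [hfpr, map_add, inner_add_left, inner_add_right, inner_add_right, hpTr, hrTp]
    ring
  have hsub : ∑ j ∈ Finset.range (n + 1), (lam j - lam n) * inner ℝ (e j) f ^ 2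
      = inner ℝ p (T p) - lam n * ‖p‖ ^ 2 := by
    rw [hpTp, hpp, Finset.mul_sum, ← Finset.sum_sub_distrib]
    exact Finset.sum_congr rfl fun j _ => by ring
  rw [hTf, hsub, hnorm]
  linarith

/-- A Ky Fan inequality for a family with bounded Gram matrix. -/
theorem IsSortedEigensystem.sum_inner_map_self_le [CompleteSpace H] {T : H →L[ℝ] H}
    {lam : ℕ → ℝ} {e : ℕ → H} (hT : IsSortedEigensystem T lam e)
    (hs : ∀ x y, inner ℝ (T x) y = inner ℝ x (T y)) {d : ℕ} (hd : 1 ≤ d)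
    (hpos : 0 < lam (d - 1)) {f : Fin d → H} {C : ℝ} (hC : 0 ≤ C)
    (hf : ∀ c : Fin d → ℝ, ‖∑ i, c i • f i‖ ^ 2 ≤ C * ∑ i, c i ^ 2) :
    ∑ i, inner ℝ (f i) (T (f i)) ≤ C * eigSum lam d := by
  obtain ⟨n, rfl⟩ : ∃ n, d = n + 1 := ⟨d - 1, by omega⟩
  rw [Nat.add_sub_cancel] at hpos
  have hfi : ∀ i, ‖f i‖ ^ 2 ≤ C := fun i => by
    have := hf (Pi.single i 1)
    simpa [Pi.single_apply, ite_smul, ite_pow] using this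
  have hw : ∀ j ∈ Finset.range (n + 1), ∑ i, inner ℝ (e j) (f i) ^ 2 ≤ C := fun j hj => by
    have hj0 : lam j ≠ 0 :=
      (hpos.trans_le (hT.antitone (Nat.lt_succ_iff.1 (Finset.mem_range.1 hj)))).ne'
    have := sum_sq_inner_le_of_gram_le hC hf (hT.orthonormal.1 ⟨j, hj0⟩)
    simpa only [real_inner_comm] using this
  calc ∑ i, inner ℝ (f i) (T (f i))
      ≤ ∑ i, (lam n * C
        + ∑ j ∈ Finset.range (n + 1), (lam j - lam n) * inner ℝ (e j) (f i) ^ 2) := by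
        refine Finset.sum_le_sum fun i _ => (hT.inner_map_self_le_add_sum hs hpos (f i)).trans ?_
        gcongr
        exact hfi i
    _ = (n + 1) * (lam n * C) + ∑ j ∈ Finset.range (n + 1),
          (lam j - lam n) * ∑ i, inner ℝ (e j) (f i) ^ 2 := by
        rw [Finset.sum_add_distrib, Finset.sum_comm]
        simp [Finset.mul_sum]
    _ ≤ (n + 1) * (lam n * C) + ∑ j ∈ Finset.range (n + 1), (lam j - lam n) * C := by
        gcongr with j hj
        · exact sub_nonneg.2 (hT.antitone (Nat.lt_succ_iff.1 (Finset.mem_range.1 hj)))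
        · exact hw j hj
    -- The `n + 1` copies of `lam n` cancel against those subtracted in the weights.
    _ = C * eigSum lam (n + 1) := by
        rw [← Finset.sum_mul, Finset.sum_sub_distrib, eigSum]
        simp
        ring

end KyFan

variable {X A : Type*} [MeasurableSpace X] [MeasurableSpace A]

/-! ### Densities and uniform second moment estimates -/

theorem integral_avg (P : Measure X) [IsProbabilityMeasure P] (Q : Kernel X A) [IsMarkovKernel Q]
    {g : A → ℝ} (hg : Integrable g (Q ∘ₘ P)) : ∫ x, avg Q g x ∂P = ∫ a, g a ∂(Q ∘ₘ P) := by
  have h1 : Integrable (fun z : X × A => g z.2) (P ⊗ₘ Q) :=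
    (Measure.integrable_compProd_snd_iff hg.1).2 hg
  have h2 := Measure.integral_compProd h1
  rw [← Measure.snd_compProd, Measure.snd, integral_map measurable_snd.aemeasurable, h2]
  · rfl
  · rw [← Measure.snd, Measure.snd_compProd]
    exact hg.1

/-- The law `p(· | x)` has a density with respect to `P_A` whose `L²` norm is at most `K`. -/
structure HasDensityBound (P : Measure X) (Q : Kernel X A) (K : ℝ) (x : X) : Prop where
  ac : Q x ≪ Q ∘ₘ P
  bound : ∫⁻ a, augDensity P Q x a ^ 2 ∂(Q ∘ₘ P) ≤ ENNReal.ofReal (K ^ 2)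

section Density

variable {P : Measure X} {Q : Kernel X A} {K : ℝ} {x : X}

theorem HasDensityBound.lintegral_le (h : HasDensityBound P Q K x) :
    ∫⁻ a, ‖(augDensity P Q x a).toReal‖ₑ ^ 2 ∂(Q ∘ₘ P) ≤ ENNReal.ofReal (K ^ 2) := by
  refine (lintegral_mono fun a => ?_).trans h.bound
  gcongr
  rw [Real.enorm_eq_ofReal_abs, abs_of_nonneg ENNReal.toReal_nonneg]
  exact ENNReal.ofReal_toReal_le

theorem measurable_toReal_augDensity (P : Measure X) (Q : Kernel X A) (x : X) :
    Measurable fun a => (augDensity P Q x a).toReal :=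
  (Measure.measurable_rnDeriv _ _).ennreal_toReal

theorem HasDensityBound.memLp (h : HasDensityBound P Q K x) :
    MemLp (fun a => (augDensity P Q x a).toReal) 2 (Q ∘ₘ P) :=
  memLp_two_of_lintegral_le (measurable_toReal_augDensity P Q x).aestronglyMeasurable
    (h.lintegral_le.trans_lt ENNReal.ofReal_lt_top).ne

theorem HasDensityBound.integral_sq_le (h : HasDensityBound P Q K x) :
    ∫ a, (augDensity P Q x a).toReal ^ 2 ∂(Q ∘ₘ P) ≤ K ^ 2 := by
  have := h.lintegral_le
  rwa [lintegral_enorm_sq_eq h.memLp, ENNReal.ofReal_le_ofReal_iff (sq_nonneg _)] at this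

variable [IsProbabilityMeasure P] [IsMarkovKernel Q]

theorem avg_eq_integral_density (h : Q x ≪ Q ∘ₘ P) (g : A → ℝ) :
    avg Q g x = ∫ a, g a * (augDensity P Q x a).toReal ∂(Q ∘ₘ P) := by
  rw [avg, ← integral_toReal_rnDeriv_mul h]
  simp only [augDensity, mul_comm]

theorem HasDensityBound.integrable (h : HasDensityBound P Q K x) {g : A → ℝ}
    (hg : MemLp g 2 (Q ∘ₘ P)) : Integrable g (Q x) := by
  rw [← integrable_rnDeriv_smul_iff h.ac]
  exact h.memLp.integrable_mul hg

/-- Cauchy-Schwarz against the density. This pointwise bound by an `L²` norm is the source of all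
sup bounds on eigenfunctions. -/
theorem HasDensityBound.abs_avg_le (hK : 0 ≤ K) (h : HasDensityBound P Q K x) {g : A → ℝ}
    (hg : MemLp g 2 (Q ∘ₘ P)) : |avg Q g x| ≤ K * √(∫ a, g a ^ 2 ∂(Q ∘ₘ P)) := by
  rw [avg_eq_integral_density h.ac, mul_comm]
  refine (abs_integral_mul_le hg h.memLp).trans ?_
  gcongr
  exact Real.sqrt_le_iff.2 ⟨hK, h.integral_sq_le⟩

end Density

theorem ae_hasDensityBound {P : Measure X} {Q : Kernel X A} (hκ : augComplexity P Q ≠ ∞) :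
    ∀ᵐ x ∂P, HasDensityBound P Q (augComplexity P Q).toReal x := by
  have hess : essSup (kernelDiag P Q) P = ENNReal.ofReal ((augComplexity P Q).toReal ^ 2) := by
    rw [ENNReal.ofReal_pow ENNReal.toReal_nonneg, ENNReal.ofReal_toReal hκ, augComplexity,
      ← ENNReal.rpow_natCast, ← ENNReal.rpow_mul]
    norm_num
  filter_upwards [ENNReal.ae_le_essSup (μ := P) (kernelDiag P Q)] with x hx
  rw [hess, kernelDiag] at hx
  split_ifs at hx with h
  · exact ⟨h, hx⟩
  · exact absurd (top_le_iff.1 hx) ENNReal.ofReal_ne_top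

theorem augComplexity_toReal_pos {P : Measure X} [IsProbabilityMeasure P] {Q : Kernel X A}
    [IsMarkovKernel Q] (hκ : augComplexity P Q ≠ ∞) : 0 < (augComplexity P Q).toReal := by
  obtain ⟨x, hx⟩ := (ae_hasDensityBound hκ).exists
  -- The constant function `1` gives `1 ≤ κ`.
  have h1 := hx.abs_avg_le ENNReal.toReal_nonneg (memLp_const (1 : ℝ))
  simp only [avg, integral_const, probReal_univ, smul_eq_mul, one_pow, mul_one, abs_one,
    Real.sqrt_one] at h1
  linarith

/-- On an event of probability at least `1 - δ`, the empirical second moments are close to the true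
ones, uniformly over all functions. -/
theorem exists_set_second_moments_close [MeasurableSpace.CountablyGenerated A]
    (P : Measure X) [IsProbabilityMeasure P] (Q : Kernel X A) [IsMarkovKernel Q]
    {K : ℝ} (hK : 0 < K) (hPK : ∀ᵐ x ∂P, HasDensityBound P Q K x) {N : ℕ} (hN : 1 ≤ N) {δ : ℝ}
    (hδ : 0 < δ) (hδ1 : δ ≤ 1) :
    ∃ E : Set (Fin N → X), MeasurableSet E ∧
      ENNReal.ofReal (1 - δ) ≤ Measure.pi (fun _ : Fin N => P) E ∧
      ∀ x ∈ E, (∀ k, HasDensityBound P Q K (x k)) ∧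
        (∀ (g : A → ℝ) (M : ℝ), MemLp g 2 (Q ∘ₘ P) → 0 ≤ M → (∀ᵐ a ∂(Q ∘ₘ P), |g a| ≤ M) →
          |(N : ℝ)⁻¹ * ∑ k, avg Q (fun a => g a ^ 2) (x k) - ∫ a, g a ^ 2 ∂(Q ∘ₘ P)|
            ≤ M * √(∫ a, g a ^ 2 ∂(Q ∘ₘ P)) * (K * (1 + √(2 * Real.log (2 / δ))) / √N)) ∧
        (∀ f : A → ℝ, MemLp f 2 (Q ∘ₘ P) →
          |(N : ℝ)⁻¹ * ∑ k, avg Q f (x k) ^ 2 - ∫ z, avg Q f z ^ 2 ∂P|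
            ≤ (∫ a, f a ^ 2 ∂(Q ∘ₘ P)) * (K ^ 2 * (1 + √(2 * Real.log (2 / δ))) / √N)) := by
  obtain ⟨S, hSP, hSm, hS0⟩ := exists_measurable_superset_of_null (ae_iff.1 hPK)
  have hgood : ∀ z, z ∉ S → HasDensityBound P Q K z := fun z hz => by
    by_contra h
    exact hz (hSP h)
  set μ := Q ∘ₘ P with hμ
  -- The kernel derivative is jointly measurable, which the pointwise densities `augDensity` need
  -- not be. Setting it to zero on the null set `S` makes the norm bound hold at every point.
  set v : X → A → ℝ := fun z a =>
    Sᶜ.indicator (fun z => (Q.rnDeriv (Kernel.const X μ) z a).toReal) z with hv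
  have hq : Measurable fun p : X × A => (Q.rnDeriv (Kernel.const X μ) p.1 p.2).toReal :=
    (Kernel.measurable_rnDeriv Q (Kernel.const X μ)).ennreal_toReal
  have hvm : Measurable (Function.uncurry v) := by
    have : Function.uncurry v = (Prod.fst ⁻¹' Sᶜ).indicator
        fun p : X × A => (Q.rnDeriv (Kernel.const X μ) p.1 p.2).toReal := by
      ext p
      by_cases hp : p.1 ∈ S <;> simp [Function.uncurry, hv, hp]
    rw [this]
    exact hq.indicator (measurable_fst hSm.compl)
  have hvae : ∀ z, z ∉ S → v z =ᵐ[μ] fun a => (augDensity P Q z a).toReal := fun z hz => by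
    filter_upwards [Kernel.rnDeriv_eq_rnDeriv_measure (κ := Q) (η := Kernel.const X μ) (a := z)]
      with a ha
    rw [Kernel.const_apply] at ha
    simp only [hv, Set.indicator_of_mem (Set.mem_compl hz), ha, augDensity]
    rfl
  have hv0 : ∀ z, z ∈ S → v z = 0 := fun z hz => by
    ext a
    simp [hv, hz]
  have hvK : ∀ z, ∫⁻ a, ‖v z a‖ₑ ^ 2 ∂μ ≤ ENNReal.ofReal (K ^ 2) := fun z => by
    by_cases hz : z ∈ S
    · simp [hv0 z hz]
    · refine le_trans (le_of_eq (lintegral_congr_ae ?_)) (hgood z hz).lintegral_le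
      filter_upwards [hvae z hz] with a ha
      rw [ha]
  have hvavg : ∀ z, z ∉ S → ∀ g : A → ℝ, ∫ a, g a * v z a ∂μ = avg Q g z := fun z hz g => by
    rw [avg_eq_integral_density (hgood z hz).ac]
    refine integral_congr_ae ?_
    filter_upwards [hvae z hz] with a ha
    rw [ha]
  have hSae : ∀ᵐ z ∂P, z ∉ S := measure_eq_zero_iff_ae_notMem.1 hS0
  -- A union bound over two deviation events, whence `log (2/δ)`.
  have hδ2 : 0 < δ / 2 := by positivity
  obtain ⟨E₁, hE₁m, hE₁P, hE₁⟩ := exists_set_uniform_deviation P μ hvm hK hvK hN hδ2 (by linarith)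
  -- The square `(Γ*f)(z)²` is quadratic in `f` but is the pairing of `f ⊗ f` with `q_z ⊗ q_z`, a
  -- vector of norm at most `K²`.
  set w : X → A × A → ℝ := fun z p => v z p.1 * v z p.2 with hw
  have hwm : Measurable (Function.uncurry w) :=
    (hvm.comp (by fun_prop : Measurable fun p : X × A × A => (p.1, p.2.1))).mul
      (hvm.comp (by fun_prop : Measurable fun p : X × A × A => (p.1, p.2.2)))
  have hvzm : ∀ z, Measurable (v z) := fun z => hvm.of_uncurry_left
  have hwK : ∀ z, ∫⁻ p, ‖w z p‖ₑ ^ 2 ∂(μ.prod μ) ≤ ENNReal.ofReal ((K ^ 2) ^ 2) := fun z => by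
    simp only [hw, enorm_mul, mul_pow]
    have hm : AEMeasurable (fun a => ‖v z a‖ₑ ^ 2) μ :=
      ((hvzm z).enorm.pow_const 2).aemeasurable
    rw [lintegral_prod_mul hm hm, ENNReal.ofReal_pow (by positivity), pow_two]
    exact mul_le_mul' (hvK z) (hvK z)
  obtain ⟨E₂, hE₂m, hE₂P, hE₂⟩ := exists_set_uniform_deviation P (μ.prod μ) hwm
    (by positivity : 0 < K ^ 2) hwK hN hδ2 (by linarith)
  rw [one_div_div] at hE₁ hE₂
  have hE₃m : MeasurableSet {x : Fin N → X | ∀ k, x k ∉ S} := by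
    rw [Set.ofPred_forall]
    exact MeasurableSet.iInter fun k => (measurable_pi_apply (X := fun _ : Fin N => X) k) hSm.compl
  have hE₃P : Measure.pi (fun _ : Fin N => P) {x : Fin N → X | ∀ k, x k ∉ S}ᶜ = 0 := by
    have : ∀ᵐ x ∂(Measure.pi fun _ : Fin N => P), ∀ k, x k ∉ S := ae_all_iff.2 fun k =>
      (measurePreserving_eval (fun _ : Fin N => P) k).quasiMeasurePreserving.ae hSae
    exact ae_iff.1 this
  refine ⟨E₁ ∩ E₂ ∩ {x | ∀ k, x k ∉ S}, (hE₁m.inter hE₂m).inter hE₃m, ?_, ?_⟩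
  · have hc : Measure.pi (fun _ : Fin N => P) (E₁ ∩ E₂ ∩ {x | ∀ k, x k ∉ S})ᶜ
        ≤ ENNReal.ofReal δ := by
      rw [Set.compl_inter, Set.compl_inter]
      refine (measure_union_le _ _).trans ?_
      rw [hE₃P, add_zero]
      refine (measure_union_le _ _).trans ((add_le_add hE₁P hE₂P).trans (le_of_eq ?_))
      rw [← ENNReal.ofReal_add hδ2.le hδ2.le, add_halves]
    rw [prob_compl_eq_one_sub ((hE₁m.inter hE₂m).inter hE₃m)] at hc
    rw [ENNReal.ofReal_sub _ hδ.le, ENNReal.ofReal_one]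
    exact tsub_le_iff_tsub_le.1 hc
  · rintro x ⟨⟨hx1, hx2⟩, hx3⟩
    refine ⟨fun k => hgood _ (hx3 k), fun g M hg hM hgM => ?_, fun f hf => ?_⟩
    · have hg2i : Integrable (fun a => g a ^ 2) μ := hg.integrable_sq
      -- The test function is `g²`, whose norm is at most `M ‖g‖`.
      have hg4 : ∀ᵐ a ∂μ, (g a ^ 2) ^ 2 ≤ M ^ 2 * g a ^ 2 := by
        filter_upwards [hgM] with a ha
        rw [pow_two (g a ^ 2)]
        exact mul_le_mul_of_nonneg_right (sq_le_sq' (abs_le.1 ha).1 (abs_le.1 ha).2) (sq_nonneg _)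
      have hg4i : Integrable (fun a => (g a ^ 2) ^ 2) μ := by
        refine (hg2i.const_mul (M ^ 2)).mono' ((hg.1.pow 2).pow 2) ?_
        filter_upwards [hg4] with a ha
        rwa [Real.norm_eq_abs, abs_of_nonneg (sq_nonneg _)]
      have hg2 : MemLp (fun a => g a ^ 2) 2 μ :=
        (memLp_two_iff_integrable_sq (hg.1.pow 2)).2 hg4i
      have h := hE₁ x hx1 _ hg2
      have hmean : ∫ z, ∫ a, g a ^ 2 * v z a ∂μ ∂P = ∫ a, g a ^ 2 ∂μ := by
        rw [← integral_avg P Q hg2i]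
        refine integral_congr_ae ?_
        filter_upwards [hSae] with z hz using hvavg z hz _
      have hemp : ∀ k, ∫ a, g a ^ 2 * v (x k) a ∂μ = avg Q (fun a => g a ^ 2) (x k) := fun k =>
        hvavg _ (hx3 k) _
      rw [hmean] at h
      simp only [hemp] at h
      refine h.trans ?_
      gcongr
      rw [← Real.sqrt_sq hM, ← Real.sqrt_mul (sq_nonneg M), ← integral_const_mul]
      exact Real.sqrt_le_sqrt (integral_mono_ae hg4i (hg2i.const_mul _) hg4)
    · have hff : MemLp (fun p : A × A => f p.1 * f p.2) 2 (μ.prod μ) := by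
        refine (memLp_two_iff_integrable_sq
          ((hf.1.comp_measurePreserving measurePreserving_fst).mul
            (hf.1.comp_measurePreserving measurePreserving_snd))).2 ?_
        simpa only [Pi.mul_apply, Function.comp_apply, mul_pow] using
          hf.integrable_sq.mul_prod hf.integrable_sq
      have h := hE₂ x hx2 _ hff
      have hwavg : ∀ z, z ∉ S → ∫ p, f p.1 * f p.2 * w z p ∂(μ.prod μ) = avg Q f z ^ 2 :=
        fun z hz => by
          rw [← hvavg z hz, pow_two, ← integral_prod_mul]
          refine integral_congr_ae (Filter.Eventually.of_forall fun p => ?_)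
          simp only [hw]
          ring
      have hmean : ∫ z, ∫ p, f p.1 * f p.2 * w z p ∂(μ.prod μ) ∂P = ∫ z, avg Q f z ^ 2 ∂P := by
        refine integral_congr_ae ?_
        filter_upwards [hSae] with z hz using hwavg z hz
      have hemp : ∀ k, ∫ p, f p.1 * f p.2 * w (x k) p ∂(μ.prod μ) = avg Q f (x k) ^ 2 := fun k =>
        hwavg _ (hx3 k)
      have hnorm : √(∫ p, (f p.1 * f p.2) ^ 2 ∂(μ.prod μ)) = ∫ a, f a ^ 2 ∂μ := by
        simp only [mul_pow]
        rw [integral_prod_mul (fun a => f a ^ 2) (fun a => f a ^ 2), Real.sqrt_mul_self]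
        exact integral_nonneg fun _ => sq_nonneg _
      rw [hmean, hnorm] at h
      simp only [hemp] at h
      exact h

/-! ### The empirical marginal -/

section EmpMarginal

variable {Q : Kernel X A} {N : ℕ} {x : Fin N → X}

theorem kernel_le_smul_empMarginal (Q : Kernel X A) (hN : 1 ≤ N) (x : Fin N → X) (k : Fin N) :
    Q (x k) ≤ (N : ℝ≥0∞) • empMarginal Q x := by
  have hN0 : (N : ℝ≥0∞) ≠ 0 := by
    rw [Nat.cast_ne_zero]
    omega
  rw [empMarginal, smul_smul, ENNReal.mul_inv_cancel hN0 (ENNReal.natCast_ne_top N), one_smul]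
  rw [← Finset.add_sum_erase _ _ (Finset.mem_univ k)]
  exact Measure.le_add_right le_rfl

theorem memLp_kernel_of_empMarginal (hN : 1 ≤ N) {p : ℝ≥0∞} {g : A → ℝ}
    (hg : MemLp g p (empMarginal Q x)) (k : Fin N) : MemLp g p (Q (x k)) :=
  hg.of_measure_le_smul (ENNReal.natCast_ne_top N) (kernel_le_smul_empMarginal Q hN x k)

theorem integral_empMarginal {g : A → ℝ} (hg : ∀ k, Integrable g (Q (x k))) :
    ∫ a, g a ∂(empMarginal Q x) = (N : ℝ)⁻¹ * ∑ k, ∫ a, g a ∂(Q (x k)) := by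
  rw [empMarginal, integral_smul_measure, integral_finsetSum_measure fun k _ => hg k]
  simp

theorem isProbabilityMeasure_empMarginal (Q : Kernel X A) [IsMarkovKernel Q] (hN : 1 ≤ N)
    (x : Fin N → X) : IsProbabilityMeasure (empMarginal Q x) := by
  have hN0 : (N : ℝ≥0∞) ≠ 0 := by
    rw [Nat.cast_ne_zero]
    omega
  constructor
  simp only [empMarginal, Measure.smul_apply, Measure.finsetSum_apply, measure_univ,
    Finset.sum_const, Finset.card_univ, Fintype.card_fin, smul_eq_mul, nsmul_eq_mul, mul_one]
  exact ENNReal.inv_mul_cancel hN0 (ENNReal.natCast_ne_top N)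

theorem empMarginal_absolutelyContinuous {μ : Measure A} (h : ∀ k, Q (x k) ≪ μ) :
    empMarginal Q x ≪ μ := by
  intro s hs
  simp [empMarginal, Measure.smul_apply, Measure.finsetSum_apply, fun k => h k hs]

theorem ae_kernel_of_ae_empMarginal (hN : 1 ≤ N) {p : A → Prop}
    (h : ∀ᵐ a ∂(empMarginal Q x), p a) (k : Fin N) : ∀ᵐ a ∂(Q (x k)), p a :=
  ((Measure.absolutelyContinuous_of_le (kernel_le_smul_empMarginal Q hN x k)).trans
    Measure.smul_absolutelyContinuous).ae_le h

theorem avg_toLp (hN : 1 ≤ N) {f : A → ℝ} (hf : MemLp f 2 (empMarginal Q x)) (k : Fin N) :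
    avg Q (hf.toLp f) (x k) = avg Q f (x k) :=
  integral_congr_ae (ae_kernel_of_ae_empMarginal hN hf.coeFn_toLp k)

end EmpMarginal

/-! ### The empirical evaluation operator -/

/-- The operator `g ↦ N^{-1/2} (E[g(A) | x_k])_k` from `L²(P̂_A)` to `ℝ^N`. -/
noncomputable def empEval (Q : Kernel X A) [IsMarkovKernel Q] {N : ℕ} (hN : 1 ≤ N) (x : Fin N → X) :
    Lp ℝ 2 (empMarginal Q x) →L[ℝ] EuclideanSpace ℝ (Fin N) :=
  LinearMap.mkContinuous
    { toFun := fun g => WithLp.toLp 2 fun k => (√N)⁻¹ * avg Q g (x k)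
      map_add' := fun g h => by
        ext k
        have hi : ∀ f : Lp ℝ 2 (empMarginal Q x), Integrable f (Q (x k)) := fun f =>
          (memLp_kernel_of_empMarginal hN (Lp.memLp f) k).integrable (by norm_num)
        have : avg Q (g + h : Lp ℝ 2 (empMarginal Q x)) (x k) = avg Q g (x k) + avg Q h (x k) := by
          rw [avg, integral_congr_ae (ae_kernel_of_ae_empMarginal hN (Lp.coeFn_add g h) k)]
          exact integral_add (hi g) (hi h)
        change (√N)⁻¹ * avg Q (g + h : Lp ℝ 2 (empMarginal Q x)) (x k)
          = (√N)⁻¹ * avg Q g (x k) + (√N)⁻¹ * avg Q h (x k)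
        rw [this, mul_add]
      map_smul' := fun c g => by
        ext k
        have : avg Q (c • g : Lp ℝ 2 (empMarginal Q x)) (x k) = c * avg Q g (x k) := by
          rw [avg, integral_congr_ae (ae_kernel_of_ae_empMarginal hN (Lp.coeFn_smul c g) k)]
          exact integral_const_mul c _
        change (√N)⁻¹ * avg Q (c • g : Lp ℝ 2 (empMarginal Q x)) (x k)
          = c * ((√N)⁻¹ * avg Q g (x k))
        rw [this, mul_left_comm] }
    1 (fun g => by
      have hg := Lp.memLp g
      have hN0 : (0 : ℝ) < N := by exact_mod_cast hN
      rw [one_mul, LinearMap.coe_mk, AddHom.coe_mk]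
      refine le_of_sq_le_sq ?_ (norm_nonneg _)
      rw [EuclideanSpace.norm_sq_eq]
      have h1 : ‖g‖ ^ 2 = ∫ a, g a ^ 2 ∂(empMarginal Q x) := by
        rw [← real_inner_self_eq_norm_sq, L2.inner_def]
        refine integral_congr_ae (Filter.Eventually.of_forall fun a => ?_)
        simp
      have hk := fun k => memLp_kernel_of_empMarginal hN hg k
      rw [h1, integral_empMarginal fun k => (hk k).integrable_sq, Finset.mul_sum]
      refine Finset.sum_le_sum fun k _ => ?_
      rw [Real.norm_eq_abs, sq_abs, mul_pow, inv_pow, Real.sq_sqrt hN0.le]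
      gcongr
      exact sq_integral_le_integral_sq (hk k))

section EmpEval

variable {Q : Kernel X A} [IsMarkovKernel Q] {N : ℕ} {x : Fin N → X}

theorem norm_empEval_le (hN : 1 ≤ N) (g : Lp ℝ 2 (empMarginal Q x)) : ‖empEval Q hN x g‖ ≤ ‖g‖ := by
  have := (empEval Q hN x).le_of_opNorm_le
    (LinearMap.mkContinuous_norm_le _ zero_le_one _) g
  rwa [one_mul] at this

theorem inner_empEval (hN : 1 ≤ N) (g h : Lp ℝ 2 (empMarginal Q x)) :
    inner ℝ (empEval Q hN x g) (empEval Q hN x h)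
      = (N : ℝ)⁻¹ * ∑ k, avg Q g (x k) * avg Q h (x k) := by
  have hN0 : (0 : ℝ) ≤ N := by positivity
  have hs : (√(N : ℝ))⁻¹ * (√(N : ℝ))⁻¹ = (N : ℝ)⁻¹ := by
    rw [← mul_inv, Real.mul_self_sqrt hN0]
  rw [Finset.mul_sum, PiLp.inner_apply]
  refine Finset.sum_congr rfl fun k _ => ?_
  simp only [empEval, LinearMap.mkContinuous_apply, LinearMap.coe_mk, AddHom.coe_mk,
    RCLike.inner_apply, conj_trivial]
  rw [← hs]
  ring

/-- The empirical operator `Γ̄ Γ*` on `L²(P̂_A)`, as `B* B` for the evaluation operator `B`. -/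
noncomputable def empCov (Q : Kernel X A) [IsMarkovKernel Q] {N : ℕ} (hN : 1 ≤ N) (x : Fin N → X) :
    Lp ℝ 2 (empMarginal Q x) →L[ℝ] Lp ℝ 2 (empMarginal Q x) :=
  (ContinuousLinearMap.adjoint (empEval Q hN x)).comp (empEval Q hN x)

theorem inner_empCov_right (hN : 1 ≤ N) (g h : Lp ℝ 2 (empMarginal Q x)) :
    inner ℝ g (empCov Q hN x h) = inner ℝ (empEval Q hN x g) (empEval Q hN x h) := by
  rw [empCov, ContinuousLinearMap.comp_apply, ContinuousLinearMap.adjoint_inner_right]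

theorem inner_empCov_left (hN : 1 ≤ N) (g h : Lp ℝ 2 (empMarginal Q x)) :
    inner ℝ (empCov Q hN x g) h = inner ℝ (empEval Q hN x g) (empEval Q hN x h) := by
  rw [empCov, ContinuousLinearMap.comp_apply, ContinuousLinearMap.adjoint_inner_left]

end EmpEval

/-! ### The empirical augmentation operator -/

section EmpAugOp

variable {P : Measure X} {Q : Kernel X A} {N : ℕ} {x : Fin N → X}

/-- The operator takes a weighted average of the values `f (x k)`, or returns `0` where all the
weights vanish. -/
theorem abs_empAugOp_le {f : X → ℝ} {C : ℝ} (hC : 0 ≤ C) (hf : ∀ k, |f (x k)| ≤ C) (a : A) :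
    |empAugOp P Q x f a| ≤ C := by
  rw [empAugOp]
  set q : Fin N → ℝ := fun k => (augDensity P Q (x k) a).toReal with hq
  have hq0 : ∀ k, 0 ≤ q k := fun k => ENNReal.toReal_nonneg
  change |(N : ℝ)⁻¹ * ∑ k, f (x k) * q k / ((N : ℝ)⁻¹ * ∑ l, q l)| ≤ C
  have hp0 : 0 ≤ (N : ℝ)⁻¹ * ∑ l, q l :=
    mul_nonneg (by positivity) (Finset.sum_nonneg fun k _ => hq0 k)
  have hsum : |∑ k, f (x k) * q k| ≤ C * ∑ k, q k := by
    rw [Finset.mul_sum]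
    refine (Finset.abs_sum_le_sum_abs _ _).trans (Finset.sum_le_sum fun k _ => ?_)
    rw [abs_mul, abs_of_nonneg (hq0 k)]
    exact mul_le_mul_of_nonneg_right (hf k) (hq0 k)
  rw [← Finset.sum_div, ← mul_div_assoc, abs_div, abs_of_nonneg hp0, abs_mul,
    abs_of_nonneg (by positivity : (0 : ℝ) ≤ (N : ℝ)⁻¹)]
  refine div_le_of_le_mul₀ hp0 hC ?_
  calc (N : ℝ)⁻¹ * |∑ k, f (x k) * q k| ≤ (N : ℝ)⁻¹ * (C * ∑ k, q k) := by gcongr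
    _ = _ := by ring

theorem measurable_empAugOp (P : Measure X) (Q : Kernel X A) {N : ℕ} (x : Fin N → X)
    (f : X → ℝ) : Measurable (empAugOp P Q x f) := by
  have h := fun k => measurable_toReal_augDensity P Q (x k)
  unfold empAugOp
  fun_prop

theorem exists_abs_empAugOp_le (P : Measure X) (Q : Kernel X A) {N : ℕ} (x : Fin N → X)
    (f : X → ℝ) : ∃ C, ∀ a, |empAugOp P Q x f a| ≤ C :=
  ⟨∑ k, |f (x k)|, abs_empAugOp_le (Finset.sum_nonneg fun _ _ => abs_nonneg _) fun k =>
    Finset.single_le_sum (f := fun k => |f (x k)|) (fun _ _ => abs_nonneg _) (Finset.mem_univ k)⟩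

theorem memLp_empAugOp (μ : Measure A) [IsFiniteMeasure μ] (P : Measure X) (Q : Kernel X A) {N : ℕ}
    (x : Fin N → X) (f : X → ℝ) (p : ℝ≥0∞) : MemLp (empAugOp P Q x f) p μ := by
  obtain ⟨C, hC⟩ := exists_abs_empAugOp_le P Q x f
  exact MemLp.of_bound (measurable_empAugOp P Q x f).aestronglyMeasurable C
    (Filter.Eventually.of_forall hC)

/-- The density of `P̂_A` cancels the denominator of `Γ̄`. Hence `Γ̄` is the adjoint, for
`L²(P̂_A)`, of evaluating averages at the sample points. -/
theorem integral_empAugOp_mul [IsProbabilityMeasure P] [IsMarkovKernel Q] (hN : 1 ≤ N)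
    (hx : ∀ k, Q (x k) ≪ Q ∘ₘ P) (f : X → ℝ) {h : A → ℝ} (hh : MemLp h 2 (empMarginal Q x)) :
    ∫ a, empAugOp P Q x f a * h a ∂(empMarginal Q x)
      = (N : ℝ)⁻¹ * ∑ k, f (x k) * avg Q h (x k) := by
  set q : Fin N → A → ℝ := fun k a => (augDensity P Q (x k) a).toReal with hq
  have hq0 : ∀ k a, 0 ≤ q k a := fun k a => ENNReal.toReal_nonneg
  have := isProbabilityMeasure_empMarginal Q hN x
  have hN0 : (N : ℝ)⁻¹ ≠ 0 := by positivity
  have hI : ∀ k, Integrable (fun a => empAugOp P Q x f a * h a) (Q (x k)) := fun k =>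
    (memLp_empAugOp (Q (x k)) P Q x f 2).integrable_mul (memLp_kernel_of_empMarginal hN hh k)
  have hhI : ∀ k, Integrable h (Q (x k)) := fun k =>
    (memLp_kernel_of_empMarginal hN hh k).integrable (by norm_num)
  have hI' : ∀ k, Integrable (fun a => q k a * (empAugOp P Q x f a * h a)) (Q ∘ₘ P) := fun k =>
    (integrable_rnDeriv_smul_iff (hx k)).2 (hI k)
  have hhI' : ∀ k, Integrable (fun a => f (x k) * (q k a * h a)) (Q ∘ₘ P) := fun k =>
    ((integrable_rnDeriv_smul_iff (hx k)).2 (hhI k)).const_mul _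
  rw [integral_empMarginal hI]
  congr 1
  have h1 : ∀ k, ∫ a, empAugOp P Q x f a * h a ∂(Q (x k))
      = ∫ a, q k a * (empAugOp P Q x f a * h a) ∂(Q ∘ₘ P) := fun k =>
    (integral_toReal_rnDeriv_mul (hx k)).symm
  have h2 : ∀ k, f (x k) * avg Q h (x k) = ∫ a, f (x k) * (q k a * h a) ∂(Q ∘ₘ P) := fun k => by
    rw [avg, ← integral_toReal_rnDeriv_mul (hx k), integral_const_mul]
    rfl
  simp only [h1, h2]
  rw [← integral_finsetSum _ fun k _ => hI' k, ← integral_finsetSum _ fun k _ => hhI' k]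
  refine integral_congr_ae (Filter.Eventually.of_forall fun a => ?_)
  simp only
  rw [← Finset.sum_mul]
  have hE : empAugOp P Q x f a = (N : ℝ)⁻¹ * ∑ k, f (x k) * q k a / ((N : ℝ)⁻¹ * ∑ l, q l a) := rfl
  rw [hE, ← Finset.sum_div]
  have h3 : ∑ k, f (x k) * (q k a * h a) = (∑ k, f (x k) * q k a) * h a := by
    rw [Finset.sum_mul]
    exact Finset.sum_congr rfl fun k _ => by ring
  rw [h3]
  -- If the denominator vanishes then so does every density, and both sides are zero.
  by_cases h0 : ∑ l, q l a = 0
  · have hz : ∀ k, q k a = 0 := fun k =>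
      (Finset.sum_eq_zero_iff_of_nonneg fun k _ => hq0 k a).1 h0 k (Finset.mem_univ k)
    simp [hz]
  · field_simp

end EmpAugOp

/-! ### Empirical eigensystems -/

section EmpEigensystem

variable {P : Measure X} {Q : Kernel X A} {N : ℕ} {x : Fin N → X}

theorem IsEmpEigensystem.ae_eq {lamBar : ℕ → ℝ} {φ : ℕ → A → ℝ}
    (h : IsEmpEigensystem P Q x lamBar φ) {i : ℕ} (hi : 0 < lamBar i) :
    φ i =ᵐ[Q ∘ₘ P] fun a => (lamBar i)⁻¹ * empAugOp P Q x (avg Q (φ i)) a := by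
  filter_upwards [h.eigen i] with a ha
  rw [ha, inv_mul_cancel_left₀ hi.ne']

variable [IsProbabilityMeasure P] [IsMarkovKernel Q]

/-- Identifies `Γ̄ Γ*` with the self-adjoint operator `B* B`, to which the Ky Fan inequality
applies. -/
theorem toLp_empAugOp_avg (hN : 1 ≤ N) (hx : ∀ k, Q (x k) ≪ Q ∘ₘ P) {f : A → ℝ}
    (hf : MemLp f 2 (empMarginal Q x)) (hE : MemLp (empAugOp P Q x (avg Q f)) 2 (empMarginal Q x)) :
    hE.toLp _ = empCov Q hN x (hf.toLp f) := by
  refine ext_inner_right ℝ fun h => ?_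
  rw [inner_empCov_left, inner_empEval]
  have h1 : inner ℝ (hE.toLp _) h = inner ℝ (hE.toLp _) ((Lp.memLp h).toLp h) := by
    rw [Lp.toLp_coeFn]
  rw [h1, inner_toLp, integral_empAugOp_mul hN hx _ (Lp.memLp h)]
  simp only [avg_toLp hN hf]

theorem IsEmpEigensystem.isSortedEigensystem (hN : 1 ≤ N) (hx : ∀ k, Q (x k) ≪ Q ∘ₘ P)
    {lamBar : ℕ → ℝ} {φ : ℕ → A → ℝ} (h : IsEmpEigensystem P Q x lamBar φ) :
    IsSortedEigensystem (empCov Q hN x) lamBar fun i => (h.memLp i).toLp (φ i) := by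
  have := isProbabilityMeasure_empMarginal Q hN x
  have hE : ∀ f, MemLp (empAugOp P Q x (avg Q f)) 2 (empMarginal Q x) := fun f =>
    memLp_empAugOp _ P Q x _ 2
  have hac := empMarginal_absolutelyContinuous hx
  refine ⟨h.antitone, h.nonneg, fun i => ?_, ?_, fun f hf => ?_⟩
  · rw [← toLp_empAugOp_avg hN hx (h.memLp i) (hE _), ← MemLp.toLp_const_smul,
      MemLp.toLp_eq_toLp_iff]
    exact hac.ae_le (h.eigen i)
  · rw [orthonormal_iff_ite]
    rintro ⟨i, hi⟩ ⟨j, hj⟩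
    rw [inner_toLp, h.orthonormal i j hi hj]
    simp
  · have hc := h.complete f (Lp.memLp f) fun i hi => by
      rw [← inner_toLp (h.memLp i) (Lp.memLp f), Lp.toLp_coeFn]
      exact hf i hi
    have h1 := toLp_empAugOp_avg hN hx (Lp.memLp f) (hE _)
    rw [Lp.toLp_coeFn] at h1
    rw [← h1, Lp.eq_zero_iff_ae_eq_zero]
    exact (hE f).coeFn_toLp.trans hc

/-- The eigenvalue equation holds `P_A`-almost everywhere and the range of `Γ̄` consists of bounded
functions. -/
theorem IsEmpEigensystem.memLp_of_pos {lamBar : ℕ → ℝ} {φ : ℕ → A → ℝ}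
    (h : IsEmpEigensystem P Q x lamBar φ) {i : ℕ} (hi : 0 < lamBar i) :
    MemLp (φ i) 2 (Q ∘ₘ P) :=
  ((memLp_empAugOp (Q ∘ₘ P) P Q x _ 2).const_mul _).ae_eq (h.ae_eq hi).symm

theorem IsEmpEigensystem.ae_abs_le {K : ℝ} (hK : 0 ≤ K) (hx : ∀ k, HasDensityBound P Q K (x k))
    {lamBar : ℕ → ℝ} {φ : ℕ → A → ℝ} (h : IsEmpEigensystem P Q x lamBar φ) {i : ℕ}
    (hi : 0 < lamBar i) :
    ∀ᵐ a ∂(Q ∘ₘ P), |φ i a| ≤ (lamBar i)⁻¹ * (K * √(∫ a, φ i a ^ 2 ∂(Q ∘ₘ P))) := by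
  filter_upwards [h.ae_eq hi] with a ha
  rw [ha, abs_mul, abs_of_pos (inv_pos.2 hi)]
  gcongr
  exact abs_empAugOp_le (by positivity) (fun k => (hx k).abs_avg_le hK (h.memLp_of_pos hi)) a

/-- The evaluation operator is a contraction, by Jensen's inequality for each `p(· | x_k)`. -/
theorem IsEmpEigensystem.le_one (hN : 1 ≤ N) (hx : ∀ k, Q (x k) ≪ Q ∘ₘ P)
    {lamBar : ℕ → ℝ} {φ : ℕ → A → ℝ} (h : IsEmpEigensystem P Q x lamBar φ) (i : ℕ) :
    lamBar i ≤ 1 := by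
  rcases eq_or_ne (lamBar i) 0 with h0 | h0
  · rw [h0]
    exact zero_le_one
  have hs := h.isSortedEigensystem hN hx
  have h1 : ‖(h.memLp i).toLp (φ i)‖ = 1 := hs.orthonormal.1 ⟨i, h0⟩
  have h2 := inner_empCov_right hN ((h.memLp i).toLp (φ i)) ((h.memLp i).toLp (φ i))
  rw [hs.eigen, real_inner_smul_right, real_inner_self_eq_norm_sq, real_inner_self_eq_norm_sq, h1]
    at h2
  have h3 := norm_empEval_le hN ((h.memLp i).toLp (φ i))
  rw [h1] at h3
  nlinarith [norm_nonneg (empEval Q hN x ((h.memLp i).toLp (φ i)))]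

end EmpEigensystem

/-! ### Gram matrices -/

theorem memLp_sum_mul {Ω : Type*} [MeasurableSpace Ω] {μ : Measure Ω} {m : ℕ} {u : Fin m → Ω → ℝ}
    (hu : ∀ i, MemLp (u i) 2 μ) (c : Fin m → ℝ) : MemLp (fun a => ∑ i, c i * u i a) 2 μ :=
  memLp_finsetSum _ fun i _ => (hu i).const_mul (c i)

theorem dotProduct_gram_mulVec {Ω : Type*} [MeasurableSpace Ω] {μ : Measure Ω} {m : ℕ}
    {u : Fin m → Ω → ℝ} (hu : ∀ i, MemLp (u i) 2 μ) (c : Fin m → ℝ) :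
    dotProduct c ((Matrix.of fun i j => ∫ a, u i a * u j a ∂μ).mulVec c)
      = ∫ a, (∑ i, c i * u i a) ^ 2 ∂μ := by
  have hI : ∀ i j, Integrable (fun a => c i * u i a * (c j * u j a)) μ := fun i j =>
    ((hu i).const_mul (c i)).integrable_mul ((hu j).const_mul (c j))
  have h1 : ∀ a, (∑ i, c i * u i a) ^ 2 = ∑ i, ∑ j, c i * u i a * (c j * u j a) := fun a => by
    rw [pow_two, Finset.sum_mul_sum]
  simp only [h1]
  rw [integral_finsetSum _ fun i _ => integrable_finsetSum _ fun j _ => hI i j]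
  simp only [dotProduct, Matrix.mulVec, Matrix.of_apply, Finset.mul_sum]
  refine Finset.sum_congr rfl fun i _ => ?_
  rw [integral_finsetSum _ fun j _ => hI i j]
  refine Finset.sum_congr rfl fun j _ => ?_
  rw [← integral_mul_const, ← integral_const_mul]
  exact integral_congr_ae (Filter.Eventually.of_forall fun a => by ring)

theorem isHermitian_gram {Ω : Type*} [MeasurableSpace Ω] (μ : Measure Ω) {m : ℕ}
    (u : Fin m → Ω → ℝ) : (Matrix.of fun i j => ∫ a, u i a * u j a ∂μ).IsHermitian := by
  ext i j
  simp [Matrix.conjTranspose_apply, mul_comm]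

theorem posSemidef_gram {Ω : Type*} [MeasurableSpace Ω] {μ : Measure Ω} {m : ℕ}
    {u : Fin m → Ω → ℝ} (hu : ∀ i, MemLp (u i) 2 μ) :
    (Matrix.of fun i j => ∫ a, u i a * u j a ∂μ).PosSemidef :=
  .of_dotProduct_mulVec_nonneg (isHermitian_gram μ u) fun c => by
    rw [star_trivial, dotProduct_gram_mulVec hu]
    exact integral_nonneg fun _ => sq_nonneg _

theorem avg_sum_mul {Q : Kernel X A} {x : X} {m : ℕ} {u : Fin m → A → ℝ}
    (hu : ∀ i, Integrable (u i) (Q x)) (c : Fin m → ℝ) :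
    avg Q (fun a => ∑ i, c i * u i a) x = ∑ i, c i * avg Q (u i) x := by
  rw [avg, integral_finsetSum _ fun i _ => (hu i).const_mul _]
  simp only [integral_const_mul, avg]

/-! ### Ratio trace and trace gap -/

section Encoder

variable {P : Measure X} [IsProbabilityMeasure P] {Q : Kernel X A} [IsMarkovKernel Q]

theorem avg_sum_mul_ae {m : ℕ} {u : Fin m → A → ℝ} (hu : ∀ i, MemLp (u i) 2 (Q ∘ₘ P))
    (c : Fin m → ℝ) :
    avg Q (fun a => ∑ i, c i * u i a) =ᵐ[P] fun x => ∑ i, c i * avg Q (u i) x := by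
  filter_upwards [ae_all_iff.2 fun i =>
    Measure.ae_integrable_of_integrable_comp ((hu i).integrable (by norm_num))] with x hx
  exact avg_sum_mul hx c

theorem integral_avg_sq_le {g : A → ℝ} (hg : MemLp g 2 (Q ∘ₘ P)) :
    ∫ x, avg Q g x ^ 2 ∂P ≤ ∫ a, g a ^ 2 ∂(Q ∘ₘ P) := by
  obtain ⟨h1, h2⟩ := memLp_avg P Q hg
  have h3 : ‖h1.toLp _‖ ≤ ‖hg.toLp g‖ := by
    rw [Lp.norm_toLp, Lp.norm_toLp]
    exact ENNReal.toReal_mono hg.2.ne h2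
  rw [norm_toLp_eq_sqrt, norm_toLp_eq_sqrt] at h3
  exact (Real.sqrt_le_sqrt_iff (integral_nonneg fun _ => sq_nonneg _)).1 h3

theorem dotProduct_gramX_mulVec {m : ℕ} {u : Fin m → A → ℝ} (hu : ∀ i, MemLp (u i) 2 (Q ∘ₘ P))
    (c : Fin m → ℝ) :
    dotProduct c ((gramX P Q u).mulVec c) = ∫ x, avg Q (fun a => ∑ i, c i * u i a) x ^ 2 ∂P := by
  rw [gramX, dotProduct_gram_mulVec fun i => (memLp_avg P Q (hu i)).1]
  refine integral_congr_ae ?_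
  filter_upwards [avg_sum_mul_ae hu c] with x hx
  rw [hx]

/-- `Γ*` is a contraction, so `F ≤ G` as quadratic forms. -/
theorem ratioTrace_le {m : ℕ} {u : Fin m → A → ℝ} (hu : ∀ i, MemLp (u i) 2 (Q ∘ₘ P))
    (hG : IsUnit (gramA P Q u).det) : ratioTrace P Q u ≤ m := by
  have hpd : (gramA P Q u).PosDef :=
    (posSemidef_gram hu).posDef_iff_isUnit.2 ((Matrix.isUnit_iff_isUnit_det _).2 hG)
  have hps : (gramA P Q u - gramX P Q u).PosSemidef := by
    refine .of_dotProduct_mulVec_nonneg ((isHermitian_gram _ _).sub (isHermitian_gram _ _))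
      fun c => ?_
    rw [star_trivial, Matrix.sub_mulVec, dotProduct_sub, dotProduct_gramX_mulVec hu, gramA,
      dotProduct_gram_mulVec hu]
    exact sub_nonneg.2 (integral_avg_sq_le (memLp_sum_mul hu c))
  have h := trace_inv_mul_nonneg hpd hps
  rw [Matrix.mul_sub, Matrix.nonsing_inv_mul _ hG, Matrix.trace_sub, Matrix.trace_one,
    Fintype.card_fin] at h
  exact sub_nonneg.1 h

theorem traceGapSq_le {lam : ℕ → ℝ} (hlam : ∀ i, 0 ≤ lam i) {d : ℕ} (hd : 1 ≤ d)
    {φ : Fin d → A → ℝ} (hφ : ∀ i, MemLp (φ i) 2 (Q ∘ₘ P)) (hG : (gramA P Q φ).PosDef) :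
    traceGapSq P Q lam φ ≤ eigSum lam (d + 1) - ratioTrace P Q φ := by
  -- The infimum is a genuine one only if the set is bounded below; the ratio trace is at most `m ≤
  -- d`. The encoder itself corresponds to the identity coefficient matrix.
  refine csInf_le ⟨-(d : ℝ), ?_⟩ ⟨d, hd, le_rfl, fun i j => if i = j then 1 else 0, ?_⟩
  · rintro t ⟨m, _, hmd, w, hw, rfl⟩
    have h1 := ratioTrace_le (fun i => memLp_sum_mul hφ (w i)) hw
    have h2 : 0 ≤ eigSum lam (m + 1) := Finset.sum_nonneg fun i _ => hlam i
    have h3 : (m : ℝ) ≤ d := by exact_mod_cast hmd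
    linarith
  · have h1 : (fun (i : Fin d) a => ∑ j, (if i = j then (1 : ℝ) else 0) * φ j a) = φ := by
      ext i a
      simp
    rw [h1]
    exact ⟨(Matrix.isUnit_iff_isUnit_det _).1 hG.isUnit, rfl⟩

end Encoder

theorem coeFn_sum_smul {Ω : Type*} [MeasurableSpace Ω] {μ : Measure Ω} {m : ℕ}
    (f : Fin m → Lp ℝ 2 μ) (c : Fin m → ℝ) :
    (∑ i, c i • f i : Lp ℝ 2 μ) =ᵐ[μ] fun a => ∑ i, c i * f i a := by
  filter_upwards [Lp.coeFn_finsetSum Finset.univ fun i => c i • f i,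
    ae_all_iff.2 fun i => Lp.coeFn_smul (c i) (f i)] with a h1 h2
  rw [h1, Finset.sum_apply]
  simp only [h2, Pi.smul_apply, smul_eq_mul]

theorem sum_smul_toLp {Ω : Type*} [MeasurableSpace Ω] {μ : Measure Ω} {m : ℕ} {u : Fin m → Ω → ℝ}
    (hu : ∀ i, MemLp (u i) 2 μ) (c : Fin m → ℝ) :
    ∑ i, c i • (hu i).toLp (u i) = (memLp_sum_mul hu c).toLp _ := by
  apply Lp.ext
  filter_upwards [coeFn_sum_smul (fun i => (hu i).toLp (u i)) c,
    (memLp_sum_mul hu c).coeFn_toLp, ae_all_iff.2 fun i => (hu i).coeFn_toLp] with a h1 h2 h3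
  rw [h1, h2]
  simp only [h3]

theorem norm_sq_toLp {Ω : Type*} [MeasurableSpace Ω] {μ : Measure Ω} {f : Ω → ℝ}
    (hf : MemLp f 2 μ) : ‖hf.toLp f‖ ^ 2 = ∫ a, f a ^ 2 ∂μ := by
  rw [norm_toLp_eq_sqrt, Real.sq_sqrt (integral_nonneg fun _ => sq_nonneg _)]

theorem norm_sq_sum_smul_of_orthonormal {H : Type*} [NormedAddCommGroup H] [InnerProductSpace ℝ H]
    {m : ℕ} {e : Fin m → H} (he : Orthonormal ℝ e) (c : Fin m → ℝ) :
    ‖∑ i, c i • e i‖ ^ 2 = ∑ i, c i ^ 2 := by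
  rw [← real_inner_self_eq_norm_sq, he.inner_sum]
  simp [pow_two]

/-! ### Population eigenfunctions -/

section Population

variable {P : Measure X} [IsProbabilityMeasure P] {Q : Kernel X A} [IsMarkovKernel Q]

/-- A conditional expectation preserves an upper bound, as comparing integrals over the events `{A ∈
B}` shows. -/
theorem augOp_ae_le {f : Lp ℝ 2 P} {C : ℝ} (hf : ∀ᵐ x ∂P, f x ≤ C) :
    ∀ᵐ a ∂(Q ∘ₘ P), augOp P Q f a ≤ C := by
  have hI : Integrable (augOp P Q f) (Q ∘ₘ P) := (Lp.memLp _).integrable (by norm_num)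
  refine ae_le_of_forall_setIntegral_le hI (integrable_const C) fun B hB _ => ?_
  rw [setIntegral_augOp P Q f hB]
  have hfst : Integrable (fun z : X × A => f z.1) (P ⊗ₘ Q) := by
    have h : Integrable f (P ⊗ₘ Q).fst := by
      rw [Measure.fst_compProd]
      exact (Lp.memLp f).integrable (by norm_num)
    exact h.comp_measurable measurable_fst
  have hae : ∀ᵐ z ∂(P ⊗ₘ Q), f z.1 ≤ C := by
    have h : ∀ᵐ x ∂(P ⊗ₘ Q).fst, f x ≤ C := by rwa [Measure.fst_compProd]
    exact ae_of_ae_map measurable_fst.aemeasurable h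
  have hmeas : (P ⊗ₘ Q).real (Set.univ ×ˢ B) = (Q ∘ₘ P).real B := by
    rw [← Measure.snd_compProd, measureReal_def, measureReal_def, Measure.snd_apply hB,
      Set.univ_prod]
  calc ∫ z in Set.univ ×ˢ B, f z.1 ∂(P ⊗ₘ Q) ≤ ∫ _ in Set.univ ×ˢ B, C ∂(P ⊗ₘ Q) :=
        integral_mono_ae hfst.integrableOn (integrable_const C) (ae_restrict_of_ae hae)
    _ = ∫ _ in B, C ∂(Q ∘ₘ P) := by simp [hmeas]

theorem abs_augOp_ae_le {f : Lp ℝ 2 P} {C : ℝ} (hf : ∀ᵐ x ∂P, |f x| ≤ C) :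
    ∀ᵐ a ∂(Q ∘ₘ P), |augOp P Q f a| ≤ C := by
  have h1 : ∀ᵐ a ∂(Q ∘ₘ P), augOp P Q f a ≤ C :=
    augOp_ae_le (hf.mono fun x hx => (le_abs_self _).trans hx)
  have h2 : ∀ᵐ a ∂(Q ∘ₘ P), augOp P Q (-f) a ≤ C := augOp_ae_le (by
    filter_upwards [hf, Lp.coeFn_neg f] with x hx hx'
    rw [hx']
    exact (neg_le_abs _).trans hx)
  rw [map_neg] at h2
  filter_upwards [h1, h2, Lp.coeFn_neg (augOp P Q f)] with a ha1 ha2 ha3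
  rw [ha3] at ha2
  exact abs_le.2 ⟨neg_le.1 ha2, ha1⟩

theorem norm_sq_Lp {Ω : Type*} [MeasurableSpace Ω] {μ : Measure Ω} (f : Lp ℝ 2 μ) :
    ‖f‖ ^ 2 = ∫ a, f a ^ 2 ∂μ := by
  rw [← norm_sq_toLp (Lp.memLp f), Lp.toLp_coeFn]

theorem abs_augAdj_ae_le {K : ℝ} (hK : 0 ≤ K) (hPK : ∀ᵐ x ∂P, HasDensityBound P Q K x)
    (u : Lp ℝ 2 (Q ∘ₘ P)) : ∀ᵐ x ∂P, |augAdj P Q u x| ≤ K * ‖u‖ := by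
  filter_upwards [hPK, augAdj_coeFn P Q u] with x hx hx'
  rw [hx', ← Real.sqrt_sq (norm_nonneg u), norm_sq_Lp]
  exact hx.abs_avg_le hK (Lp.memLp u)

/-- The normalized left singular functions `λ_i^{-1/2} Γ ψ_i`. -/
noncomputable def popEigenfunction (P : Measure X) [IsProbabilityMeasure P] (Q : Kernel X A)
    [IsMarkovKernel Q] (lam : ℕ → ℝ) (ψ : ℕ → Lp ℝ 2 P) (i : ℕ) : Lp ℝ 2 (Q ∘ₘ P) :=
  (√(lam i))⁻¹ • augOp P Q (ψ i)

variable {lam : ℕ → ℝ} {ψ : ℕ → Lp ℝ 2 P}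

theorem augAdj_popEigenfunction
    (h : IsSortedEigensystem ((augAdj P Q).comp (augOp P Q)) lam ψ) (i : ℕ) :
    augAdj P Q (popEigenfunction P Q lam ψ i) = √(lam i) • ψ i := by
  have h1 : augAdj P Q (augOp P Q (ψ i)) = lam i • ψ i := h.eigen i
  rw [popEigenfunction, map_smul, h1, smul_smul, ← div_eq_inv_mul, Real.div_sqrt]

theorem augOp_augAdj_popEigenfunction
    (h : IsSortedEigensystem ((augAdj P Q).comp (augOp P Q)) lam ψ) (i : ℕ) :
    augOp P Q (augAdj P Q (popEigenfunction P Q lam ψ i))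
      = lam i • popEigenfunction P Q lam ψ i := by
  rw [augAdj_popEigenfunction h, popEigenfunction, map_smul, smul_smul, ← div_eq_mul_inv,
    Real.div_sqrt]

theorem orthonormal_popEigenfunction
    (h : IsSortedEigensystem ((augAdj P Q).comp (augOp P Q)) lam ψ) {d : ℕ}
    (hpos : ∀ i : Fin d, 0 < lam i) :
    Orthonormal ℝ fun i : Fin d => popEigenfunction P Q lam ψ i := by
  rw [orthonormal_iff_ite]
  intro i j
  have h1 := orthonormal_iff_ite.1 h.orthonormal ⟨i, (hpos i).ne'⟩ ⟨j, (hpos j).ne'⟩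
  simp only [Subtype.mk.injEq, Fin.val_inj] at h1
  have h2 : inner ℝ (augOp P Q (ψ i)) (popEigenfunction P Q lam ψ j)
      = inner ℝ (ψ i) (augAdj P Q (popEigenfunction P Q lam ψ j)) :=
    ContinuousLinearMap.adjoint_inner_left _ _ _
  nth_rw 1 [popEigenfunction]
  rw [real_inner_smul_left, h2, augAdj_popEigenfunction h, real_inner_smul_right, h1]
  split_ifs with hij
  · subst hij
    have := Real.sqrt_pos.2 (hpos i)
    field_simp
  · simp

theorem integral_avg_popEigenfunction_sq
    (h : IsSortedEigensystem ((augAdj P Q).comp (augOp P Q)) lam ψ) {i : ℕ} (hi : 0 < lam i) :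
    ∫ x, avg Q (popEigenfunction P Q lam ψ i) x ^ 2 ∂P = lam i := by
  have h1 : ∫ x, avg Q (popEigenfunction P Q lam ψ i) x ^ 2 ∂P
      = ‖augAdj P Q (popEigenfunction P Q lam ψ i)‖ ^ 2 := by
    rw [norm_sq_Lp]
    refine integral_congr_ae ?_
    filter_upwards [augAdj_coeFn P Q (popEigenfunction P Q lam ψ i)] with x hx
    rw [hx]
  have h2 : ‖ψ i‖ = 1 := h.orthonormal.1 ⟨i, hi.ne'⟩
  rw [h1, augAdj_popEigenfunction h, norm_smul, h2, mul_one, Real.norm_eq_abs, sq_abs,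
    Real.sq_sqrt hi.le]

/-- The combination equals `Γ Γ* u`, where `u` has the coefficients `c i / lam i`. Here `Γ*` maps
`L²` to bounded functions with constant `K`, and `Γ` preserves sup bounds. Treating the combination
as a whole avoids a factor growing with `d`. -/
theorem abs_sum_popEigenfunction_ae_le {K : ℝ} (hK : 0 ≤ K)
    (hPK : ∀ᵐ x ∂P, HasDensityBound P Q K x)
    (h : IsSortedEigensystem ((augAdj P Q).comp (augOp P Q)) lam ψ) {d : ℕ}
    (hpos : 0 < lam (d - 1)) (c : Fin d → ℝ) :
    ∀ᵐ a ∂(Q ∘ₘ P), |∑ i : Fin d, c i * popEigenfunction P Q lam ψ i a|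
      ≤ K * ((lam (d - 1))⁻¹ * √(∑ i, c i ^ 2)) := by
  have hle : ∀ i : Fin d, lam (d - 1) ≤ lam i := fun i => h.antitone (by omega)
  have hp : ∀ i : Fin d, 0 < lam i := fun i => hpos.trans_le (hle i)
  set u : Lp ℝ 2 (Q ∘ₘ P) := ∑ i : Fin d, (c i / lam i) • popEigenfunction P Q lam ψ i with hu
  have hun : ‖u‖ ≤ (lam (d - 1))⁻¹ * √(∑ i, c i ^ 2) := by
    refine le_of_sq_le_sq ?_ (by positivity)
    rw [hu, norm_sq_sum_smul_of_orthonormal (orthonormal_popEigenfunction h hp), mul_pow,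
      Real.sq_sqrt (Finset.sum_nonneg fun _ _ => sq_nonneg _), Finset.mul_sum]
    refine Finset.sum_le_sum fun i _ => ?_
    rw [div_pow, div_eq_inv_mul, ← inv_pow]
    have h1 := hle i
    have h2 := hp i
    gcongr
  have hGu : augOp P Q (augAdj P Q u) = ∑ i : Fin d, c i • popEigenfunction P Q lam ψ i := by
    rw [hu, map_sum, map_sum]
    refine Finset.sum_congr rfl fun i _ => ?_
    rw [map_smul, map_smul, augOp_augAdj_popEigenfunction h i, smul_smul,
      div_mul_cancel₀ _ (hp i).ne']
  have h1 := abs_augOp_ae_le (Q := Q) (abs_augAdj_ae_le hK hPK u)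
  rw [hGu] at h1
  filter_upwards [h1, coeFn_sum_smul (fun i : Fin d => popEigenfunction P Q lam ψ i) c]
    with a ha1 ha2
  rw [ha2] at ha1
  exact ha1.trans (mul_le_mul_of_nonneg_left hun hK)

end Population

/-! ### Comparison of population and empirical spectra -/

section Comparison

variable {P : Measure X} [IsProbabilityMeasure P] {Q : Kernel X A} [IsMarkovKernel Q] {N d : ℕ}
  {x : Fin N → X} {lamBar : ℕ → ℝ} {φ : ℕ → A → ℝ} {K r : ℝ}

theorem inner_empCov_toLp (hN : 1 ≤ N) {g : A → ℝ} (hg : MemLp g 2 (empMarginal Q x)) :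
    inner ℝ (hg.toLp g) (empCov Q hN x (hg.toLp g)) = (N : ℝ)⁻¹ * ∑ k, avg Q g (x k) ^ 2 := by
  rw [inner_empCov_right, inner_empEval]
  simp only [avg_toLp hN hg, pow_two]

theorem IsEmpEigensystem.orthonormal_toLp (hN : 1 ≤ N) (hx : ∀ k, Q (x k) ≪ Q ∘ₘ P)
    (h : IsEmpEigensystem P Q x lamBar φ) (hpos : ∀ i : Fin d, 0 < lamBar i) :
    Orthonormal ℝ fun i : Fin d => (h.memLp i).toLp (φ i) :=
  (h.isSortedEigensystem hN hx).orthonormal.comp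
    (fun i : Fin d => (⟨i, (hpos i).ne'⟩ : {i : ℕ // lamBar i ≠ 0}))
    fun _ _ hij => Fin.ext (congrArg Subtype.val hij)

/-- A combination that vanishes `P_A`-almost everywhere also vanishes `P̂_A`-almost everywhere, and
orthonormality in `L²(P̂_A)` forces its coefficients to be zero. -/
theorem IsEmpEigensystem.posDef_gramA (hN : 1 ≤ N) (hx : ∀ k, Q (x k) ≪ Q ∘ₘ P)
    (h : IsEmpEigensystem P Q x lamBar φ) (hpos : ∀ i : Fin d, 0 < lamBar i) :
    (gramA P Q fun i : Fin d => φ i).PosDef := by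
  have hφ : ∀ i : Fin d, MemLp (φ i) 2 (Q ∘ₘ P) := fun i => h.memLp_of_pos (hpos i)
  refine .of_dotProduct_mulVec_pos (isHermitian_gram _ _) fun c hc => ?_
  rw [star_trivial, gramA, dotProduct_gram_mulVec hφ]
  refine (integral_nonneg fun _ => sq_nonneg _).lt_of_ne fun h0 => hc ?_
  have hae := (integral_eq_zero_iff_of_nonneg (fun _ => sq_nonneg _)
    (memLp_sum_mul hφ c).integrable_sq).1 h0.symm
  have h1 := norm_sq_sum_smul_of_orthonormal (h.orthonormal_toLp hN hx hpos) c
  rw [sum_smul_toLp (fun i : Fin d => h.memLp i) c, norm_sq_toLp,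
    integral_congr_ae ((empMarginal_absolutelyContinuous hx).ae_le hae)] at h1
  simp only [Pi.zero_apply, integral_zero] at h1
  ext i
  have := (Finset.sum_eq_zero_iff_of_nonneg fun i _ => sq_nonneg (c i)).1 h1.symm i
    (Finset.mem_univ i)
  simpa using this

/-- The empirical version of the matrix `F` is diagonal, with the empirical eigenvalues as entries.
-/
theorem IsEmpEigensystem.mean_sq_avg_sum (hN : 1 ≤ N) (hx : ∀ k, Q (x k) ≪ Q ∘ₘ P)
    (h : IsEmpEigensystem P Q x lamBar φ) (hpos : ∀ i : Fin d, 0 < lamBar i) (c : Fin d → ℝ) :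
    (N : ℝ)⁻¹ * ∑ k, avg Q (fun a => ∑ i : Fin d, c i * φ i a) (x k) ^ 2
      = ∑ i : Fin d, lamBar i * c i ^ 2 := by
  have hs := h.isSortedEigensystem hN hx
  have hν : ∀ i : Fin d, MemLp (φ i) 2 (empMarginal Q x) := fun i => h.memLp i
  rw [← inner_empCov_toLp hN (memLp_sum_mul hν c), ← sum_smul_toLp hν c, map_sum]
  have h1 : ∀ i : Fin d, empCov Q hN x (c i • (hν i).toLp (φ i))
      = (c i * lamBar i) • (hν i).toLp (φ i) := fun i => by
    rw [map_smul, hs.eigen i, smul_smul]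
  simp only [h1]
  rw [(h.orthonormal_toLp hN hx hpos).inner_sum]
  refine Finset.sum_congr rfl fun i _ => ?_
  rw [conj_trivial]
  ring

/-- The ratio trace of the empirical eigenfunctions is close to the sum of the empirical
eigenvalues. -/
theorem IsEmpEigensystem.eigSum_le_ratioTrace (hN : 1 ≤ N) (hd : 1 ≤ d) (hK : 0 ≤ K) (hr : 0 ≤ r)
    (hx : ∀ k, HasDensityBound P Q K (x k)) (h : IsEmpEigensystem P Q x lamBar φ)
    (hpos : 0 < lamBar (d - 1))
    (h₁ : ∀ (g : A → ℝ) (M : ℝ), MemLp g 2 (Q ∘ₘ P) → 0 ≤ M → (∀ᵐ a ∂(Q ∘ₘ P), |g a| ≤ M) →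
      |(N : ℝ)⁻¹ * ∑ k, avg Q (fun a => g a ^ 2) (x k) - ∫ a, g a ^ 2 ∂(Q ∘ₘ P)|
        ≤ M * √(∫ a, g a ^ 2 ∂(Q ∘ₘ P)) * (K * r))
    (h₂ : ∀ f : A → ℝ, MemLp f 2 (Q ∘ₘ P) →
      |(N : ℝ)⁻¹ * ∑ k, avg Q f (x k) ^ 2 - ∫ z, avg Q f z ^ 2 ∂P|
        ≤ (∫ a, f a ^ 2 ∂(Q ∘ₘ P)) * (K ^ 2 * r)) :
    eigSum lamBar d ≤ ratioTrace P Q (fun i : Fin d => φ i)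
      + (K ^ 2 * r + K ^ 2 * r * (lamBar (d - 1))⁻¹) * d := by
  have hac : ∀ k, Q (x k) ≪ Q ∘ₘ P := fun k => (hx k).ac
  have hle : ∀ i : Fin d, lamBar (d - 1) ≤ lamBar i := fun i => h.antitone (by omega)
  have hp : ∀ i : Fin d, 0 < lamBar i := fun i => hpos.trans_le (hle i)
  have hφ : ∀ i : Fin d, MemLp (φ i) 2 (Q ∘ₘ P) := fun i => h.memLp_of_pos (hp i)
  have hG := h.posDef_gramA hN hac hp
  set G := gramA P Q fun i : Fin d => φ i with hGdef
  set F := gramX P Q fun i : Fin d => φ i with hFdef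
  set D : Matrix (Fin d) (Fin d) ℝ := Matrix.diagonal fun i => lamBar i with hD
  set a := K ^ 2 * r with ha
  set β := a * (lamBar (d - 1))⁻¹ with hβ
  have ha0 : 0 ≤ a := by positivity
  have hβ0 : 0 ≤ β := by positivity
  -- `φ i` has norm one in `L²(P̂_A)`, and its sup bound is proportional to `√(G i i)`, so the
  -- deviation estimate reads `|1 - G i i| ≤ β * G i i`.
  have hdiag : ∀ i : Fin d, (1 - β) * G i i ≤ 1 := fun i => by
    have hGi : G i i = ∫ a, φ i a ^ 2 ∂(Q ∘ₘ P) := by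
      simp only [hGdef, gramA, Matrix.of_apply, pow_two]
    have hG0 : 0 ≤ G i i := by
      rw [hGi]
      exact integral_nonneg fun _ => sq_nonneg _
    have hb := h₁ (φ i) _ (hφ i) (by have := hp i; positivity) (h.ae_abs_le hK hx (hp i))
    have hone : (N : ℝ)⁻¹ * ∑ k, avg Q (fun a => φ i a ^ 2) (x k) = 1 := by
      have := integral_empMarginal (Q := Q) (x := x) (g := fun a => φ i a ^ 2) fun k =>
        (memLp_kernel_of_empMarginal hN (h.memLp i) k).integrable_sq
      simp only [avg]
      rw [← this]
      simpa [pow_two] using h.orthonormal i i (hp i).ne' (hp i).ne'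
    rw [hone, ← hGi] at hb
    have h3 : (lamBar i)⁻¹ * (K * √(G i i)) * √(G i i) * (K * r)
        = a * (lamBar i)⁻¹ * (√(G i i) * √(G i i)) := by rw [ha]; ring
    rw [h3, Real.mul_self_sqrt hG0] at hb
    have h4 : a * (lamBar i)⁻¹ * G i i ≤ β * G i i := by
      have := hle i
      rw [hβ]
      gcongr
    linarith [(abs_le.1 hb).1]
  have hps : (F - D + a • G).PosSemidef := by
    have hDH : D.IsHermitian := Matrix.isHermitian_diagonal _
    have hGH : (a • G).IsHermitian := by
      have := hG.isHermitian
      rw [Matrix.IsHermitian, Matrix.conjTranspose_smul, this.eq, star_trivial]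
    refine .of_dotProduct_mulVec_nonneg (((isHermitian_gram _ _).sub hDH).add hGH) fun c => ?_
    have hDq : dotProduct c (D.mulVec c) = ∑ i : Fin d, lamBar i * c i ^ 2 := by
      simp only [hD, dotProduct, Matrix.mulVec_diagonal]
      exact Finset.sum_congr rfl fun i _ => by ring
    rw [star_trivial, Matrix.add_mulVec, Matrix.sub_mulVec, dotProduct_add, dotProduct_sub,
      Matrix.smul_mulVec, dotProduct_smul, hFdef, dotProduct_gramX_mulVec hφ, hGdef, gramA,
      dotProduct_gram_mulVec hφ, hDq, ← h.mean_sq_avg_sum hN hac hp, smul_eq_mul]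
    have := h₂ _ (memLp_sum_mul hφ c)
    linarith [(abs_le.1 this).2]
  have htr := trace_inv_mul_nonneg hG hps
  have hdet : IsUnit G.det := (Matrix.isUnit_iff_isUnit_det _).1 hG.isUnit
  rw [Matrix.mul_add, Matrix.mul_sub, Matrix.mul_smul, Matrix.nonsing_inv_mul _ hdet,
    Matrix.trace_add, Matrix.trace_sub, Matrix.trace_smul, Matrix.trace_one, Fintype.card_fin,
    smul_eq_mul] at htr
  have hsum : eigSum lamBar d = ∑ i : Fin d, lamBar i := Finset.sum_range _
  -- Since `D` is diagonal, only the diagonal entries of `G⁻¹` contribute.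
  have hDtr : (1 - β) * eigSum lamBar d ≤ (G⁻¹ * D).trace := by
    rw [hsum, Finset.mul_sum, Matrix.trace]
    refine Finset.sum_le_sum fun i _ => ?_
    rw [Matrix.diag_apply, hD, Matrix.mul_diagonal]
    exact mul_le_mul_of_nonneg_right (le_inv_diag hG i (hdiag i)) (hp i).le
  have hSd : eigSum lamBar d ≤ d := by
    rw [hsum]
    calc ∑ i : Fin d, lamBar i ≤ ∑ _ : Fin d, (1 : ℝ) :=
          Finset.sum_le_sum fun i _ => h.le_one hN hac i
      _ = d := by simp
  have hR : ratioTrace P Q (fun i : Fin d => φ i) = (G⁻¹ * F).trace := rfl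
  rw [hR]
  nlinarith

/-- The sum of the empirical eigenvalues is at least the sum of the true eigenvalues, up to a small
error. -/
theorem IsEmpEigensystem.eigSum_le_eigSum (hN : 1 ≤ N) (hd : 1 ≤ d) (hK : 0 ≤ K) (hr : 0 ≤ r)
    (hPK : ∀ᵐ x ∂P, HasDensityBound P Q K x) (hx : ∀ k, HasDensityBound P Q K (x k))
    {lam : ℕ → ℝ} {ψ : ℕ → Lp ℝ 2 P}
    (hlam : IsSortedEigensystem ((augAdj P Q).comp (augOp P Q)) lam ψ)
    (h : IsEmpEigensystem P Q x lamBar φ) (hlpos : 0 < lam (d - 1)) (hpos : 0 < lamBar (d - 1))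
    (h₁ : ∀ (g : A → ℝ) (M : ℝ), MemLp g 2 (Q ∘ₘ P) → 0 ≤ M → (∀ᵐ a ∂(Q ∘ₘ P), |g a| ≤ M) →
      |(N : ℝ)⁻¹ * ∑ k, avg Q (fun a => g a ^ 2) (x k) - ∫ a, g a ^ 2 ∂(Q ∘ₘ P)|
        ≤ M * √(∫ a, g a ^ 2 ∂(Q ∘ₘ P)) * (K * r))
    (h₂ : ∀ f : A → ℝ, MemLp f 2 (Q ∘ₘ P) →
      |(N : ℝ)⁻¹ * ∑ k, avg Q f (x k) ^ 2 - ∫ z, avg Q f z ^ 2 ∂P|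
        ≤ (∫ a, f a ^ 2 ∂(Q ∘ₘ P)) * (K ^ 2 * r)) :
    eigSum lam d ≤ eigSum lamBar d + (K ^ 2 * r + K ^ 2 * r * (lam (d - 1))⁻¹) * d := by
  have hac : ∀ k, Q (x k) ≪ Q ∘ₘ P := fun k => (hx k).ac
  have hp : ∀ i : Fin d, 0 < lam i := fun i => hlpos.trans_le (hlam.antitone (by omega))
  have := isProbabilityMeasure_empMarginal Q hN x
  set f : Fin d → Lp ℝ 2 (Q ∘ₘ P) := fun i => popEigenfunction P Q lam ψ i with hf
  have hforth : Orthonormal ℝ f := orthonormal_popEigenfunction hlam hp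
  have hfμ : ∀ i, MemLp (f i) 2 (Q ∘ₘ P) := fun i => Lp.memLp _
  have hsup := abs_sum_popEigenfunction_ae_le hK hPK hlam hlpos
  -- Square integrability does not pass from `P_A` to `P̂_A`, but an almost sure bound does, by
  -- absolute continuity.
  have hfν : ∀ i, MemLp (f i) 2 (empMarginal Q x) := fun i => by
    have hacν := empMarginal_absolutelyContinuous hac
    refine MemLp.of_bound ((hfμ i).1.mono_ac hacν)
      (K * ((lam (d - 1))⁻¹ * √(∑ j, (Pi.single i 1 : Fin d → ℝ) j ^ 2)))
      (hacν.ae_le ?_)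
    filter_upwards [hsup (Pi.single i 1)] with a ha
    simpa [Pi.single_apply] using ha
  set a := K ^ 2 * r with ha
  set α := a * (lam (d - 1))⁻¹ with hα
  have ha0 : 0 ≤ a := by positivity
  have hα0 : 0 ≤ α := by positivity
  -- The combination has squared norm `∑ c i ^ 2` in `L²(P_A)`, and changing to `P̂_A` costs at most
  -- a factor `1 + α`.
  have hgram : ∀ c : Fin d → ℝ, ‖∑ i, c i • (hfν i).toLp (f i)‖ ^ 2 ≤ (1 + α) * ∑ i, c i ^ 2 :=
    fun c => by
      have hg := memLp_sum_mul hfμ c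
      have hgn : ∫ a, (∑ i, c i * f i a) ^ 2 ∂(Q ∘ₘ P) = ∑ i, c i ^ 2 := by
        rw [← norm_sq_sum_smul_of_orthonormal hforth c, norm_sq_Lp]
        refine integral_congr_ae ?_
        filter_upwards [coeFn_sum_smul f c] with a ha'
        rw [ha']
      have hs0 : 0 ≤ ∑ i, c i ^ 2 := Finset.sum_nonneg fun _ _ => sq_nonneg _
      have hb := h₁ _ _ hg (by positivity) (hsup c)
      have hν := memLp_sum_mul hfν c
      have hemp := integral_empMarginal (Q := Q) (x := x) fun k =>
        (memLp_kernel_of_empMarginal hN hν k).integrable_sq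
      simp only [avg] at hb
      rw [← hemp, hgn] at hb
      have h3 : K * ((lam (d - 1))⁻¹ * √(∑ i, c i ^ 2)) * √(∑ i, c i ^ 2) * (K * r)
          = α * (√(∑ i, c i ^ 2) * √(∑ i, c i ^ 2)) := by rw [hα, ha]; ring
      rw [h3, Real.mul_self_sqrt hs0] at hb
      rw [sum_smul_toLp hfν c, norm_sq_toLp]
      linarith [(abs_le.1 hb).2]
  have hs := h.isSortedEigensystem hN hac
  have hky := hs.sum_inner_map_self_le
    (fun u v => by rw [inner_empCov_left, inner_empCov_right]) hd hpos (by positivity) hgram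
  have hterm : ∀ i : Fin d, lam i - a
      ≤ inner ℝ ((hfν i).toLp (f i)) (empCov Q hN x ((hfν i).toLp (f i))) := fun i => by
    rw [inner_empCov_toLp]
    have hb := h₂ _ (hfμ i)
    have h3 : ∫ a, f i a ^ 2 ∂(Q ∘ₘ P) = 1 := by
      rw [← norm_sq_Lp, hforth.1 i, one_pow]
    have h4 : ∫ z, avg Q (f i) z ^ 2 ∂P = lam i := integral_avg_popEigenfunction_sq hlam (hp i)
    rw [h3, one_mul, h4] at hb
    linarith [(abs_le.1 hb).1]
  have hsum : ∑ i : Fin d, (lam i - a) = eigSum lam d - d * a := by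
    rw [Finset.sum_sub_distrib, eigSum, Finset.sum_range]
    simp
  have hSd : eigSum lamBar d ≤ d := by
    rw [eigSum]
    exact (Finset.sum_le_sum fun i _ => h.le_one hN hac i).trans (by simp)
  -- This gives `S_λ(d) - d a ≤ (1 + α) S_λ̄(d)`, and the excess `α S_λ̄(d)` is at most `α d`
  -- because every `λ̄_i ≤ 1`.
  have htot := (Finset.sum_le_sum fun i _ => hterm i).trans hky
  rw [hsum] at htot
  nlinarith

end Comparison

end AugRKHS

open AugRKHS

/-! ### The main theorem -/

theorem theorem2 {X A : Type*} [MeasurableSpace X] [MeasurableSpace A]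
    [MeasurableSpace.CountablyGenerated A]
    (P : Measure X) [IsProbabilityMeasure P] (Q : Kernel X A) [IsMarkovKernel Q]
    (hκ : augComplexity P Q ≠ ∞)
    (lam : ℕ → ℝ) (ψ : ℕ → Lp ℝ 2 P)
    (hlam : IsSortedEigensystem ((augAdj P Q).comp (augOp P Q)) lam ψ)
    (d N : ℕ) (hd : 1 ≤ d) (hN : 1 ≤ N) (δ : ℝ) (hδ : 0 < δ) :
    ∃ E : Set (Fin N → X), MeasurableSet E ∧
      ENNReal.ofReal (1 - δ) ≤ Measure.pi (fun _ : Fin N => P) E ∧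
      ∀ x ∈ E, ∀ (lamBar : ℕ → ℝ) (φBar : ℕ → A → ℝ), IsEmpEigensystem P Q x lamBar φBar →
        ∀ φ : Fin d → A → ℝ, (∀ i, φ i = φBar i) →
          (0 < lamBar (d - 1) → (∀ i, MemLp (φ i) 2 (Q ∘ₘ P)) ∧ (gramA P Q φ).PosDef) ∧
          ((∀ i, MemLp (φ i) 2 (Q ∘ₘ P)) → (gramA P Q φ).PosDef →
            traceGapSq P Q lam φ ≤ eigSum lam (d + 1) - ratioTrace P Q φ) ∧
          (0 < lam (d - 1) → 0 < lamBar (d - 1) →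
            eigSum lam (d + 1) - ratioTrace P Q φ ≤
              lam d + (2 + Real.sqrt (2 * Real.log (2 / δ))) *
                (((lam (d - 1))⁻¹ + (lamBar (d - 1))⁻¹ * Real.sqrt (condNumber (gramA P Q φ)) + 2)
                  * (augComplexity P Q).toReal ^ 2 / Real.sqrt N) * d) := by
  rcases le_or_gt δ 1 with hδ1 | hδ1
  swap
  -- For `δ > 1` the required probability is negative and the empty event suffices.
  · refine ⟨∅, MeasurableSet.empty, ?_, fun x hx => absurd hx (Set.notMem_empty x)⟩
    rw [ENNReal.ofReal_of_nonpos (by linarith)]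
    exact zero_le
  set K := (augComplexity P Q).toReal with hKdef
  have hK : 0 < K := augComplexity_toReal_pos hκ
  have hPK := ae_hasDensityBound hκ
  obtain ⟨E, hEm, hEP, hE⟩ := exists_set_second_moments_close P Q hK hPK hN hδ hδ1
  refine ⟨E, hEm, hEP, fun x hx lamBar φBar h φ hφ => ?_⟩
  obtain ⟨hxk, h₁, h₂⟩ := hE x hx
  obtain rfl : φ = fun i : Fin d => φBar i := funext hφ
  set L := √(2 * Real.log (2 / δ)) with hL
  set r := (1 + L) / √N with hr
  have hL0 : 0 ≤ L := Real.sqrt_nonneg _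
  have hr0 : 0 ≤ r := by positivity
  have hpd : 0 < lamBar (d - 1) → (gramA P Q fun i : Fin d => φBar i).PosDef := fun hpos =>
    h.posDef_gramA hN (fun k => (hxk k).ac) fun i => hpos.trans_le (h.antitone (by omega))
  refine ⟨fun hpos => ⟨fun i => h.memLp_of_pos (hpos.trans_le (h.antitone (by omega))), hpd hpos⟩,
    fun hm hG => traceGapSq_le hlam.nonneg hd hm hG, fun hlpos hpos => ?_⟩
  simp only [mul_div_assoc] at h₁ h₂
  have hA := h.eigSum_le_ratioTrace hN hd hK.le hr0 hxk hpos h₁ h₂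
  have hB := h.eigSum_le_eigSum hN hd hK.le hr0 hPK hxk hlam hlpos hpos h₁ h₂
  have hcond : 1 ≤ √(condNumber (gramA P Q fun i : Fin d => φBar i)) :=
    Real.one_le_sqrt.2 (one_le_condNumber hd (hpd hpos))
  have hS : eigSum lam (d + 1) = eigSum lam d + lam d := Finset.sum_range_succ _ _
  set s := √(condNumber (gramA P Q fun i : Fin d => φBar i)) with hs
  -- The two comparisons give the bound with `1 + L` and without `γ_G`; enlarging to `2 + L` and
  -- using `1 ≤ γ_G^{1/2}` yields the stated form.
  have hfin : K ^ 2 * r * ((lam (d - 1))⁻¹ + (lamBar (d - 1))⁻¹ + 2) * d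
      ≤ (2 + L) * (((lam (d - 1))⁻¹ + (lamBar (d - 1))⁻¹ * s + 2) * K ^ 2 / √N) * d := by
    have e1 : K ^ 2 * r * ((lam (d - 1))⁻¹ + (lamBar (d - 1))⁻¹ + 2) * d
        = (1 + L) * (((lam (d - 1))⁻¹ + (lamBar (d - 1))⁻¹ * 1 + 2) * K ^ 2 / √N) * d := by
      rw [hr]
      ring
    rw [e1]
    gcongr
    norm_num
  linarith
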